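/- **Definitions.** An $N$-partitioned hypergraph $H$ is a (finite) $3$-uniform hypergraph whose vertex set is partitioned into sets $V_{ij}$, $1\le i<j\le N$, such that for every edge $e$ there are $1\le i<j<k\le N$ such that $e$ consists of one vertex of $V_{ij}$, one of $V_{jk}$ and one of $V_{ik}$; the edges of this form for fixed $i<j<k$ are the $(i,j,k)$-triad. The density of the $(i,j,k)$-triad is the number of its edges divided by $|V_{ij}|\cdot|V_{ik}|\cdot|V_{jk}|$ (it is $0$ if one of the parts is empty), and the density of $H$ is the minimum density of a triad of $H$. Let $c\in V_{ik}$. A vertex $a\in V_{ij}$ is a left neighbor of $c$ if the $(i,j,k)$-triad has an edge containing $a$ and $c$, and a vertex $b\in V_{jk}$ is a right neighbor of $c$ if the $(i,j,k)$-triad has an edge containing $b$ and $c$. For $I\subseteq\{1,\dots,N\}$, an $|I|$-partitioned subhypergraph of $H$ with index set $I$ has as its parts the sets $V_{ij}$ with $i<j$, $i,j\in I$, and as its edges some of the edges of $H$ all of whose vertices lie in these parts. **Theorem.** For every real $\delta>0$ and every integer $n\ge 1$, there exists $N\in\mathbb N$ such that every $N$-partitioned hypergraph $H$ with density at least $4/27+\delta$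 has a $4n$-partitioned subhypergraph $H_0$ with index set $I=\{i_1,\ldots,i_{4n}\}$, $i_1<i_2<\cdots<i_{4n}$, such that one of the following holds (edges, triads and neighbors are those of $H_0$). 1. There exist vertices $\alpha_{ij},\beta_{ij},\gamma^0_{ij},\omega_{ij},\alpha^{\omega}_{ij},\gamma^{\omega}_{ij}\in V_{ij}$ for all $i<j$, $i,j\in I$, such that for all $i<j<k$, $i,j,k\in I$, the sets $\{\alpha_{ij},\beta_{jk},\gamma^0_{ik}\}$, $\{\omega_{ij},\beta_{jk},\gamma^{\omega}_{ik}\}$ and $\{\alpha^{\omega}_{ij},\omega_{jk},\gamma^0_{ik}\}$ are edges. 2. There exist vertices $\alpha_{ij},\beta_{ij},\gamma^0_{ij},\omega_{ij},\beta^{\omega}_{ij},\gamma^{\omega}_{ij}\in V_{ij}$ for all $i<j$, $i,j\in I$, such that for all $i<j<k$, $i,j,k\in I$, the sets $\{\alpha_{ij},\beta_{jk},\gamma^0_{ik}\}$, $\{\alpha_{ij},\omega_{jk},\gamma^{\omega}_{ik}\}$ and $\{\omega_{ij},\beta^{\omega}_{jk},\gamma^0_{ik}\}$ are edges. 3. There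 exist vertices $\alpha_{ij},\beta_{ij},\alpha'_{ij},\beta'_{ij},\gamma^0_{ij},\gamma^{\bullet}_{ij}\in V_{ij}$ for all $i<j$, $i,j\in I$, and $\beta^{\bullet}_{ijkst}\in V_{jk}$ and $\alpha^{\bullet}_{ijkst}\in V_{ks}$ for all $i<j<k<s<t$, $i,j,k,s,t\in I$, such that for all $i<j<k<s<t$, $i,j,k,s,t\in I$, - $\{\alpha_{ij},\beta_{jk},\gamma^0_{ik}\}$ is an edge in the $(i,j,k)$-triad, - $\{\alpha'_{ij},\beta^{\bullet}_{ijkst},\gamma^0_{ik}\}$ is an edge in the $(i,j,k)$-triad, - $\{\beta^{\bullet}_{ijkst},\alpha^{\bullet}_{ijkst},\gamma^{\bullet}_{js}\}$ is an edge in the $(j,k,s)$-triad, and - $\{\alpha^{\bullet}_{ijkst},\beta'_{st},\gamma^0_{kt}\}$ is an edge in the $(k,s,t)$-triad. 4. There exist vertices $\alpha^*_{ij},\beta^*_{ij},\gamma_{ij},\alpha^1_{ij},\beta^1_{ij},\gamma^1_{ij},\alpha^2_{ij},\beta^2_{ij},\gamma^2_{ij}\in V_{ij}$ for all $i<j$,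 $i,j\in I$, such that for all $i<j<k$, $i,j,k\in I$, the sets $\{\gamma^1_{ij},\beta^*_{jk},\gamma_{ik}\}$, $\{\alpha^*_{ij},\gamma^2_{jk},\gamma_{ik}\}$, $\{\alpha^1_{ij},\beta^1_{jk},\gamma^1_{ik}\}$ and $\{\alpha^2_{ij},\beta^2_{jk},\gamma^2_{ik}\}$ are edges. In addition, there exist $\alpha\in V_{i_{2n}i_{2n+1}}$ and $\beta\in V_{i_{2n+1}i_{2n+2}}$ such that $\alpha$ is a left neighbor of $\gamma^1_{i_{2n}i_{3n+1}}$, $\beta$ is a right neighbor of $\gamma^2_{i_ni_{2n+2}}$, and the $(i_{2n},i_{2n+1},i_{2n+2})$-triad contains an edge containing $\alpha$ and $\beta$. -/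

import Mathlib

/-- An `N`-partitioned hypergraph whose vertices are taken from a type `V`.  The index `m` of the
usual labelling `1, …, N` is the element `m - 1` of `Fin N`.  The vertex set is the disjoint union
of the finite sets `part i j`, `i < j` (the values `part i j` with `j ≤ i` play no role), and every
edge consists of one vertex of `part i j`, one of `part j k` and one of `part i k`
for some `i < j < k`. -/
structure PartitionedHypergraph (V : Type*) [DecidableEq V] (N : ℕ) where
  part : Fin N → Fin N → Finset V
  part_disjoint : ∀ i j k l : Fin N, i < j → k < l → (i, j) ≠ (k, l) →
    Disjoint (part i j) (part k l)
  edges : Finset (Finset V)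
  edges_spec : ∀ e ∈ edges, ∃ i j k : Fin N, i < j ∧ j < k ∧
    ∃ a ∈ part i j, ∃ b ∈ part j k, ∃ c ∈ part i k, e = {a, b, c}

namespace PartitionedHypergraph

/-- A partitioned hypergraph is 3-uniform. -/
theorem card_of_mem_edges {V : Type*} [DecidableEq V] {N : ℕ} (H : PartitionedHypergraph V N)
    {e : Finset V} (he : e ∈ H.edges) : e.card = 3 := by
  obtain ⟨i, j, k, hij, hjk, a, ha, b, hb, c, hc, rfl⟩ := H.edges_spec e he
  have hik := hij.trans hjk
  have hab : a ≠ b := fun h => Finset.disjoint_left.1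
    (H.part_disjoint i j j k hij hjk (by simp [hij.ne])) ha (h ▸ hb)
  have hac : a ≠ c := fun h => Finset.disjoint_left.1
    (H.part_disjoint i j i k hij hik (by simp [hjk.ne])) ha (h ▸ hc)
  have hbc : b ≠ c := fun h => Finset.disjoint_left.1
    (H.part_disjoint j k i k hjk hik (by simp [hij.ne'])) hb (h ▸ hc)
  exact Finset.card_eq_three.2 ⟨a, b, c, hab, hac, hbc, rfl⟩

/-- The `(i,j,k)`-triad, for `i < j < k`: the set of the edges with one (left) vertex in
`part i j`, one (right) vertex in `part j k` and one (top) vertex in `part i k`. -/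
def triad {V : Type*} [DecidableEq V] {N : ℕ} (H : PartitionedHypergraph V N) (i j k : Fin N) :
    Finset (Finset V) :=
  H.edges.filter fun e =>
    ∃ a ∈ H.part i j, ∃ b ∈ H.part j k, ∃ c ∈ H.part i k, e = {a, b, c}

/-- The density of the `(i,j,k)`-triad (equal to `0` if one of its three parts is empty). -/
noncomputable def triadDensity {V : Type*} [DecidableEq V] {N : ℕ}
    (H : PartitionedHypergraph V N) (i j k : Fin N) : ℝ :=
  ((H.triad i j k).card : ℝ) /
    (((H.part i j).card : ℝ) * ((H.part i k).card : ℝ) * ((H.part j k).card : ℝ))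

/-- The density of a partitioned hypergraph: the minimum of the densities of its triads.  It is
extended-real-valued only because there are no triads if `N < 3`, where the minimum is `⊤`. -/
noncomputable def density {V : Type*} [DecidableEq V] {N : ℕ}
    (H : PartitionedHypergraph V N) : EReal :=
  ⨅ (i : Fin N) (j : Fin N) (k : Fin N) (_ : i < j) (_ : j < k), (H.triadDensity i j k : EReal)

theorem le_density_iff {V : Type*} [DecidableEq V] {N : ℕ}
    (H : PartitionedHypergraph V N) (d : ℝ) :
    (d : EReal) ≤ H.density ↔ ∀ i j k : Fin N, i < j → j < k → d ≤ H.triadDensity i j k := by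
  simp [density, le_iInf_iff]

/-- `H₀` is the `M`-partitioned subhypergraph of `H` with index set `{ι 0 < ι 1 < ⋯ < ι (M - 1)}`:
its parts are the parts of `H` indexed by pairs from the index set, and its edges are
some of the edges of `H`. The index `ι m` of `H` is the index `m` of `H₀`. -/
def IsSubhypergraph {V : Type*} [DecidableEq V] {M N : ℕ} (H₀ : PartitionedHypergraph V M)
    (H : PartitionedHypergraph V N) (ι : Fin M ↪o Fin N) : Prop :=
  (∀ i j : Fin M, i < j → H₀.part i j = H.part (ι i) (ι j)) ∧ H₀.edges ⊆ H.edges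

/-- `a` is a left neighbor of the top vertex `c` in the `(i,j,k)`-triad. -/
def IsLeftNeighbor {V : Type*} [DecidableEq V] {N : ℕ} (H : PartitionedHypergraph V N)
    (i j k : Fin N) (a c : V) : Prop :=
  a ∈ H.part i j ∧ c ∈ H.part i k ∧ ∃ e ∈ H.triad i j k, a ∈ e ∧ c ∈ e

/-- `b` is a right neighbor of the top vertex `c` in the `(i,j,k)`-triad. -/
def IsRightNeighbor {V : Type*} [DecidableEq V] {N : ℕ} (H : PartitionedHypergraph V N)
    (i j k : Fin N) (b c : V) : Prop :=
  b ∈ H.part j k ∧ c ∈ H.part i k ∧ ∃ e ∈ H.triad i j k, b ∈ e ∧ c ∈ e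

/-- A choice of a vertex `x i j` in each part `part i j`, `i < j`. -/
def IsChoice {V : Type*} [DecidableEq V] {N : ℕ} (H : PartitionedHypergraph V N)
    (x : Fin N → Fin N → V) : Prop :=
  ∀ i j : Fin N, i < j → x i j ∈ H.part i j

/-- The first configuration. -/
def FirstCase {V : Type*} [DecidableEq V] {N : ℕ} (H : PartitionedHypergraph V N) : Prop :=
  ∃ α β γ₀ ω αω γω : Fin N → Fin N → V,
    H.IsChoice α ∧ H.IsChoice β ∧ H.IsChoice γ₀ ∧
    H.IsChoice ω ∧ H.IsChoice αω ∧ H.IsChoice γω ∧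
    ∀ i j k : Fin N, i < j → j < k →
      {α i j, β j k, γ₀ i k} ∈ H.edges ∧
      {ω i j, β j k, γω i k} ∈ H.edges ∧
      {αω i j, ω j k, γ₀ i k} ∈ H.edges

/-- The second configuration. -/
def SecondCase {V : Type*} [DecidableEq V] {N : ℕ} (H : PartitionedHypergraph V N) : Prop :=
  ∃ α β γ₀ ω βω γω : Fin N → Fin N → V,
    H.IsChoice α ∧ H.IsChoice β ∧ H.IsChoice γ₀ ∧
    H.IsChoice ω ∧ H.IsChoice βω ∧ H.IsChoice γω ∧
    ∀ i j k : Fin N, i < j → j < k →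
      {α i j, β j k, γ₀ i k} ∈ H.edges ∧
      {α i j, ω j k, γω i k} ∈ H.edges ∧
      {ω i j, βω j k, γ₀ i k} ∈ H.edges

/-- The third configuration (`βb`, `αb`, `γb` are the vertices marked with a bullet). -/
def ThirdCase {V : Type*} [DecidableEq V] {N : ℕ} (H : PartitionedHypergraph V N) : Prop :=
  ∃ (α β α' β' γ₀ γb : Fin N → Fin N → V)
    (βb αb : Fin N → Fin N → Fin N → Fin N → Fin N → V),
    H.IsChoice α ∧ H.IsChoice β ∧ H.IsChoice α' ∧ H.IsChoice β' ∧
    H.IsChoice γ₀ ∧ H.IsChoice γb ∧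
    (∀ i j k s t : Fin N, i < j → j < k → k < s → s < t →
      βb i j k s t ∈ H.part j k ∧ αb i j k s t ∈ H.part k s) ∧
    ∀ i j k s t : Fin N, i < j → j < k → k < s → s < t →
      {α i j, β j k, γ₀ i k} ∈ H.triad i j k ∧
      {α' i j, βb i j k s t, γ₀ i k} ∈ H.triad i j k ∧
      {βb i j k s t, αb i j k s t, γb j s} ∈ H.triad j k s ∧
      {αb i j k s t, β' s t, γ₀ k t} ∈ H.triad k s t

/-- The `m`-th smallest index, `1 ≤ m ≤ N`, of an `N`-partitioned hypergraph. -/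
def idx {N : ℕ} (m : ℕ) (h : 1 ≤ m ∧ m ≤ N) : Fin N := ⟨m - 1, by omega⟩

/-- The fourth configuration with the roles of `γ¹` and `γ²` with respect to the two special
vertices `a` and `b` swapped (`αs`, `βs` are the vertices marked with a star). -/
def SwappedFourthCase {V : Type*} [DecidableEq V] (n : ℕ) (hn : 1 ≤ n)
    (H : PartitionedHypergraph V (4 * n)) : Prop :=
  ∃ αs βs γ α₁ β₁ γ₁ α₂ β₂ γ₂ : Fin (4 * n) → Fin (4 * n) → V,
    H.IsChoice αs ∧ H.IsChoice βs ∧ H.IsChoice γ ∧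
    H.IsChoice α₁ ∧ H.IsChoice β₁ ∧ H.IsChoice γ₁ ∧
    H.IsChoice α₂ ∧ H.IsChoice β₂ ∧ H.IsChoice γ₂ ∧
    (∀ i j k : Fin (4 * n), i < j → j < k →
      {γ₁ i j, βs j k, γ i k} ∈ H.edges ∧
      {αs i j, γ₂ j k, γ i k} ∈ H.edges ∧
      {α₁ i j, β₁ j k, γ₁ i k} ∈ H.edges ∧
      {α₂ i j, β₂ j k, γ₂ i k} ∈ H.edges) ∧
    let iₙ : Fin (4 * n) := idx n (by omega)
    let i₂ₙ : Fin (4 * n) := idx (2 * n) (by omega)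
    let i₂ₙ₁ : Fin (4 * n) := idx (2 * n + 1) (by omega)
    let i₂ₙ₂ : Fin (4 * n) := idx (2 * n + 2) (by omega)
    let i₃ₙ₁ : Fin (4 * n) := idx (3 * n + 1) (by omega)
    ∃ a ∈ H.part i₂ₙ i₂ₙ₁, ∃ b ∈ H.part i₂ₙ₁ i₂ₙ₂,
      H.IsLeftNeighbor i₂ₙ i₂ₙ₁ i₃ₙ₁ a (γ₁ i₂ₙ i₃ₙ₁) ∧
      H.IsRightNeighbor iₙ i₂ₙ₁ i₂ₙ₂ b (γ₂ iₙ i₂ₙ₂) ∧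
      ∃ e ∈ H.triad i₂ₙ i₂ₙ₁ i₂ₙ₂, a ∈ e ∧ b ∈ e

end PartitionedHypergraph

/-! The problem reduces to palettes: sets `P` of triples of colours, read as (left, right, top).
`exists_palette` passes to a subset of the indices and picks `M` vertices in each part, repetitions
allowed, such that all triads induce the same palette on them, of density at least 4/27 + δ/2. Each
of the four configurations follows from a pattern of at most five triples in `P`, because the same
colours can be used at all indices. It remains to show that a palette without these patterns has
density at most 4/27 (`palette_card_le`).

The vertices are picked in `M` rounds. In each round a share 1/M of the uniform weight on every part
moves to a single vertex. The first-order change of a triad density is a sum of three terms, one per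
part, each of mean zero over the choice of the vertex. So a positive proportion of each part is
harmless; `exists_selection` makes one choice serve all surrounding indices, and Ramsey's theorem
makes the three terms nearly independent of the triad. A round costs O(1/M²), all rounds together
O(1/M) (`exists_blendSum_ge`).

For the palette bound, let the link of a top colour w be its set of (left, right) pairs, with
projections L(w) and R(w). Without the patterns, no link meets L(w) × L(w), R(w) × R(w), R(w) ×
L(w), or L(g) × R(h) with g in L(z) and h in R(z). Take z with the largest link, and g, h with the
largest links among L(z), R(z). The excluded rectangles bound the three links, and the real
inequality `density_bound` finishes. The value 4/27 is attained when x, z range over two thirds of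
the colours and y over the other third. -/

/-! ### Ramsey's theorem for sets and for increasing triples. -/

/-- Finite Ramsey theorem for `r`-element subsets of a finite linear order and finitely many
colours. -/
theorem exists_homogeneous (κ : Type) [Finite κ] (r : ℕ) : ∀ m : ℕ, ∃ N : ℕ,
    ∀ (I : Type) [LinearOrder I] (S : Finset I), N ≤ S.card → ∀ col : Finset I → κ,
      ∃ T ⊆ S, T.card = m ∧ ∃ c, ∀ A ⊆ T, A.card = r → col A = c := by
  classical
  have := Fintype.ofFinite κ
  induction r with
  | zero =>
    intro m
    refine ⟨m, fun I _ S hS col => ?_⟩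
    obtain ⟨T, hT, hc⟩ := Finset.exists_subset_card_eq hS
    refine ⟨T, hT, hc, col ∅, fun A _ hA => ?_⟩
    rw [Finset.card_eq_zero.1 hA]
  | succ r ih =>
    -- On such a set the colour of an `(r + 1)`-subset depends only on its minimum; a pigeonhole
    -- over the minima then gives a homogeneous set.
    have pre : ∀ k : ℕ, ∃ N : ℕ, ∀ (I : Type) [LinearOrder I] (S : Finset I), N ≤ S.card →
        ∀ col : Finset I → κ, ∃ T ⊆ S, T.card = k ∧ ∃ f : I → κ, ∀ x ∈ T, ∀ A ⊆ T,
          A.card = r → (∀ y ∈ A, x < y) → col (insert x A) = f x := by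
      intro k
      induction k with
      | zero =>
        refine ⟨1, fun I _ S hS col => ⟨∅, by simp, rfl, ?_⟩⟩
        obtain ⟨x, -⟩ := Finset.card_pos.1 hS
        exact ⟨fun _ => col ∅, by simp⟩
      | succ k ihk =>
        obtain ⟨N₁, h₁⟩ := ihk
        obtain ⟨N₂, h₂⟩ := ih N₁
        refine ⟨N₂ + 1, fun I _ S hS col => ?_⟩
        have hne : S.Nonempty := Finset.card_pos.1 (by omega)
        set x := S.min' hne with hx
        have hxS : x ∈ S := S.min'_mem hne
        obtain ⟨T', hT', hc', c, hcol⟩ := h₂ I (S.erase x)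
          (by rw [Finset.card_erase_of_mem hxS]; omega) (fun A => col (insert x A))
        obtain ⟨T, hT, hcT, f, hf⟩ := h₁ I T' hc'.ge col
        have hTS : T ⊆ S.erase x := hT.trans hT'
        have hlt : ∀ y ∈ T, x < y := fun y hy =>
          lt_of_le_of_ne (S.min'_le y (Finset.mem_of_mem_erase (hTS hy)))
            (Finset.ne_of_mem_erase (hTS hy)).symm
        have hxT : x ∉ T := fun h => lt_irrefl _ (hlt x h)
        refine ⟨insert x T, ?_, by rw [Finset.card_insert_of_notMem hxT, hcT],
          Function.update f x c, ?_⟩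
        · exact Finset.insert_subset hxS (hTS.trans (Finset.erase_subset _ _))
        · intro y hy A hA hAr hlA
          have hxA : x ∉ A := by
            intro h
            rcases Finset.mem_insert.1 hy with rfl | hyT
            · exact lt_irrefl _ (hlA _ h)
            · exact lt_asymm (hlA _ h) (hlt _ hyT)
          have hAT : A ⊆ T := fun z hz => (Finset.mem_insert.1 (hA hz)).resolve_left
            (fun h => hxA (h ▸ hz))
          rcases Finset.mem_insert.1 hy with rfl | hyT
          · rw [Function.update_self]
            exact hcol A (hAT.trans hT) hAr
          · rw [Function.update_of_ne (show y ≠ x from fun h => hxT (by rw [← h]; exact hyT))]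
            exact hf y hyT A hAT hAr hlA
    intro m
    obtain ⟨N, hN⟩ := pre (Fintype.card κ * m + 1)
    refine ⟨N, fun I _ S hS col => ?_⟩
    obtain ⟨T, hT, hcT, f, hf⟩ := hN I S hS col
    obtain ⟨c, -, hc⟩ := Finset.exists_lt_card_fiber_of_mul_lt_card_of_maps_to
      (s := T) (t := Finset.univ) (f := f) (n := m) (by simp) (by rw [hcT]; simp)
    obtain ⟨T', hT', hcT'⟩ := Finset.exists_subset_card_eq hc.le
    have hT'T : T' ⊆ T := hT'.trans (Finset.filter_subset _ _)
    refine ⟨T', hT'T.trans hT, hcT', c, fun A hA hAr => ?_⟩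
    have hne : A.Nonempty := Finset.card_pos.1 (by omega)
    have hm := A.min'_mem hne
    rw [← Finset.insert_erase hm, hf _ (hT'T (hA hm)) (A.erase (A.min' hne))
      ((Finset.erase_subset _ _).trans (hA.trans hT'T))
      (by rw [Finset.card_erase_of_mem hm]; omega)
      (fun y hy => lt_of_le_of_ne (A.min'_le y (Finset.mem_of_mem_erase hy))
        (Finset.ne_of_mem_erase hy).symm)]
    exact (Finset.mem_filter.1 (hT' (hA hm))).2

/-- Ramsey theorem for colourings of the increasing triples. -/
theorem exists_homogeneous_triples (κ : Type) [Finite κ] (m : ℕ) : ∃ N : ℕ,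
    ∀ (I : Type) [LinearOrder I] (S : Finset I), N ≤ S.card → ∀ col : I → I → I → κ,
      ∃ T ⊆ S, T.card = m ∧ ∃ c, ∀ i ∈ T, ∀ j ∈ T, ∀ k ∈ T, i < j → j < k → col i j k = c := by
  classical
  obtain ⟨N, hN⟩ := exists_homogeneous κ 3 m
  -- The extra element makes `S` nonempty; `x₀` only serves the default colour of sets that are not
  -- increasing triples.
  refine ⟨N + 1, fun I _ S hS col => ?_⟩
  obtain ⟨x₀, -⟩ := Finset.card_pos.1 (by omega : 0 < S.card)
  let P : Finset I → I × I × I → Prop := fun A t =>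
    t.1 < t.2.1 ∧ t.2.1 < t.2.2 ∧ A = {t.1, t.2.1, t.2.2}
  let col' : Finset I → κ := fun A =>
    if h : ∃ t, P A t then col h.choose.1 h.choose.2.1 h.choose.2.2 else col x₀ x₀ x₀
  obtain ⟨T, hT, hc, c, hcol⟩ := hN I S (by omega) col'
  refine ⟨T, hT, hc, c, fun i hi j hj k hk hij hjk => ?_⟩
  have hex : ∃ t, P {i, j, k} t := ⟨(i, j, k), hij, hjk, rfl⟩
  have hcard : ({i, j, k} : Finset I).card = 3 :=
    Finset.card_eq_three.2 ⟨i, j, k, hij.ne, (hij.trans hjk).ne, hjk.ne, rfl⟩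
  have hsub : ({i, j, k} : Finset I) ⊆ T := by
    intro x hx
    simp only [Finset.mem_insert, Finset.mem_singleton] at hx
    rcases hx with rfl | rfl | rfl <;> assumption
  have key := hcol _ hsub hcard
  simp only [col', dif_pos hex] at key
  obtain ⟨h1, h2, h3⟩ := hex.choose_spec
  generalize hex.choose = t at key h1 h2 h3
  obtain ⟨i', j', k'⟩ := t
  simp only at key h1 h2 h3
  have e1 : i' ∈ ({i, j, k} : Finset I) := by rw [h3]; simp
  have e2 : j' ∈ ({i, j, k} : Finset I) := by rw [h3]; simp
  have e3 : k' ∈ ({i, j, k} : Finset I) := by rw [h3]; simp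
  have hik := hij.trans hjk
  simp only [Finset.mem_insert, Finset.mem_singleton] at e1 e2 e3
  have : i' = i ∧ j' = j ∧ k' = k := by
    rcases e1 with rfl | rfl | rfl <;> rcases e2 with rfl | rfl | rfl <;>
      rcases e3 with rfl | rfl | rfl <;>
      first
        | exact ⟨rfl, rfl, rfl⟩
        | exact absurd h1 (by order)
  obtain ⟨rfl, rfl, rfl⟩ := this
  exact key

/-! ### Common elements of dense families and simultaneous selection. -/

/-- If many sets of a family have a positive proportion of the elements of `X` on average, then
some `m` of them have a positive proportion of `X` in common. -/
theorem exists_common_of_average (p : ℝ) (hp : 0 < p) (m : ℕ) : ∃ (q : ℕ) (p' : ℝ), 0 < p' ∧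
    ∀ {ι α : Type*} (B : Finset ι) (X : Finset α) (G : ι → α → Prop) [∀ t, DecidablePred (G t)],
      B.card = q → p * (q * X.card) ≤ ∑ t ∈ B, ((X.filter (G t)).card : ℝ) →
      ∃ A ⊆ B, A.card = m ∧ ∃ Y ⊆ X, p' * X.card ≤ Y.card ∧ ∀ x ∈ Y, ∀ t ∈ A, G t x := by
  classical
  -- The first summand gives `2 * m ≤ p * q`, the second gives `m ≤ q` without assuming `p ≤ 1`.
  obtain ⟨q, hq''⟩ := exists_nat_gt (2 * m / p + m)
  have hmq' : m ≤ q := by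
    have h : (0 : ℝ) ≤ 2 * m / p := by positivity
    have : (m : ℝ) ≤ q := by linarith
    exact_mod_cast this
  have hq : 2 * m / p < q := by
    have : (0 : ℝ) ≤ m := by positivity
    linarith
  have hq0 : 0 < (q : ℝ) := lt_of_le_of_lt (by positivity) hq
  have hq' : 2 * (m : ℝ) ≤ p * q := by
    rw [div_lt_iff₀ hp] at hq; linarith
  -- Elements outside `X'` contribute at most `m ≤ p * q / 2` each, so `X'` has at least `p / 2 *
  -- X.card` elements. It is covered by at most `2 ^ q` intersections of `m` sets, so one of these
  -- is large.
  refine ⟨q, p / 4 / 2 ^ q, by positivity, fun {ι α} B X G _ hB hsum => ?_⟩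
  set X' := X.filter fun x => m ≤ (B.filter fun t => G t x).card with hX'
  have hdc : ∑ t ∈ B, ((X.filter (G t)).card : ℝ)
      = ∑ x ∈ X, ((B.filter fun t => G t x).card : ℝ) := by
    simp only [Finset.card_filter]
    push_cast
    exact Finset.sum_comm
  have hup : ∑ x ∈ X, ((B.filter fun t => G t x).card : ℝ) ≤ X'.card * q + X.card * m := by
    have h1 : ∀ x ∈ X, ((B.filter fun t => G t x).card : ℝ)
        ≤ (if m ≤ (B.filter fun t => G t x).card then (q : ℝ) else 0) + m := by
      intro x _
      split_ifs with h
      · have : (B.filter fun t => G t x).card ≤ q := hB ▸ Finset.card_filter_le _ _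
        have : ((B.filter fun t => G t x).card : ℝ) ≤ q := by exact_mod_cast this
        have : (0 : ℝ) ≤ m := by positivity
        linarith
      · have : ((B.filter fun t => G t x).card : ℝ) ≤ m := by exact_mod_cast (not_le.1 h).le
        linarith
    refine (Finset.sum_le_sum h1).trans (le_of_eq ?_)
    rw [Finset.sum_add_distrib, ← Finset.sum_filter]
    simp [hX']
  have hX'card : p / 2 * X.card ≤ X'.card := by
    have h2 : p * (q * X.card) ≤ X'.card * q + X.card * m := hsum.trans (hdc ▸ hup)
    have h3 : (X.card : ℝ) * (2 * m) ≤ X.card * (p * q) := by gcongr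
    have h4 : (p / 2 * X.card) * q ≤ X'.card * q := by nlinarith
    exact le_of_mul_le_mul_right h4 hq0
  by_contra! hcon
  have hex : ∀ A ∈ B.powersetCard m,
      ((X.filter fun x => ∀ t ∈ A, G t x).card : ℝ) < p / 4 / 2 ^ q * X.card := by
    intro A hA
    rw [Finset.mem_powersetCard] at hA
    by_contra! h
    obtain ⟨x, hx, t, ht, hG⟩ := hcon A hA.1 hA.2 _ (Finset.filter_subset _ _) h
    exact hG ((Finset.mem_filter.1 hx).2 t ht)
  have hcov : X' ⊆ (B.powersetCard m).biUnion fun A => X.filter fun x => ∀ t ∈ A, G t x := by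
    intro x hx
    rw [hX', Finset.mem_filter] at hx
    obtain ⟨A, hA, hAc⟩ := Finset.exists_subset_card_eq hx.2
    rw [Finset.mem_biUnion]
    exact ⟨A, Finset.mem_powersetCard.2 ⟨hA.trans (Finset.filter_subset _ _), hAc⟩,
      Finset.mem_filter.2 ⟨hx.1, fun t ht => (Finset.mem_filter.1 (hA ht)).2⟩⟩
  have hle : (X'.card : ℝ) ≤ p / 4 * X.card := by
    have h1 : (X'.card : ℝ) ≤ ∑ A ∈ B.powersetCard m,
        ((X.filter fun x => ∀ t ∈ A, G t x).card : ℝ) := by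
      exact_mod_cast (Finset.card_le_card hcov).trans Finset.card_biUnion_le
    refine h1.trans ((Finset.sum_le_sum fun A hA => (hex A hA).le).trans ?_)
    rw [Finset.sum_const, nsmul_eq_mul, Finset.card_powersetCard, hB]
    have h2 : ((q.choose m : ℕ) : ℝ) ≤ 2 ^ q := by exact_mod_cast Nat.choose_le_two_pow q m
    calc ((q.choose m : ℕ) : ℝ) * (p / 4 / 2 ^ q * X.card)
        ≤ 2 ^ q * (p / 4 / 2 ^ q * X.card) := by gcongr
      _ = p / 4 * X.card := by field_simp
  have hmq : m ≤ B.card := by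
    rw [hB]
    exact hmq'
  obtain ⟨A, hA⟩ := Finset.powersetCard_nonempty.2 hmq
  have := hex A hA
  have h0 : 0 < (X.card : ℝ) := by
    by_contra! h
    have h' : (X.card : ℝ) = 0 := le_antisymm h (by positivity)
    rw [h', mul_zero] at this
    exact absurd this (not_lt.2 (by positivity))
  nlinarith

/-- A positive proportion of `X` in all the sets `X ∩ G h s k` forces a common element over some
box of prescribed size. -/
theorem exists_common_of_box (p : ℝ) (hp : 0 < p) (m : ℕ) : ∃ q : ℕ,
    ∀ {ι : Type} {V : Type*} (B₁ B₂ B₃ : Finset ι) (X : Finset V) (G : ι → ι → ι → V → Prop)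
      [∀ h s k, DecidablePred (G h s k)], X.Nonempty →
      q ≤ B₁.card → q ≤ B₂.card → q ≤ B₃.card →
      (∀ h ∈ B₁, ∀ s ∈ B₂, ∀ k ∈ B₃, p * X.card ≤ ((X.filter (G h s k)).card : ℝ)) →
      ∃ A₁ ⊆ B₁, ∃ A₂ ⊆ B₂, ∃ A₃ ⊆ B₃, A₁.card = m ∧ A₂.card = m ∧ A₃.card = m ∧
        ∃ x ∈ X, ∀ h ∈ A₁, ∀ s ∈ A₂, ∀ k ∈ A₃, G h s k x := by
  classical
  obtain ⟨q₁, p₁, hp₁, H₁⟩ := exists_common_of_average p hp m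
  obtain ⟨q₂, p₂, hp₂, H₂⟩ := exists_common_of_average p₁ hp₁ m
  obtain ⟨q₃, p₃, hp₃, H₃⟩ := exists_common_of_average p₂ hp₂ m
  refine ⟨max q₁ (max q₂ q₃), fun {ι V} B₁ B₂ B₃ X G _ hX h₁ h₂ h₃ hG => ?_⟩
  obtain ⟨C₁, hC₁, hc₁⟩ := Finset.exists_subset_card_eq ((le_max_left _ _).trans h₁)
  obtain ⟨C₂, hC₂, hc₂⟩ := Finset.exists_subset_card_eq
    (((le_max_left _ _).trans (le_max_right _ _)).trans h₂)
  obtain ⟨C₃, hC₃, hc₃⟩ := Finset.exists_subset_card_eq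
    (((le_max_right _ _).trans (le_max_right _ _)).trans h₃)
  -- slices of a set of pairs
  have slice : ∀ {β γ : Type _} (C : Finset β) (Z : Finset γ) (Y : Finset (β × γ)), Y ⊆ C ×ˢ Z →
      ∀ [∀ t, DecidablePred fun z => (t, z) ∈ Y],
      (Y.card : ℝ) = ∑ t ∈ C, ((Z.filter fun z => (t, z) ∈ Y).card : ℝ) := by
    intro β γ C Z Y hY _
    have h1 := Finset.card_eq_sum_card_fiberwise (f := Prod.fst) (s := Y) (t := C)
      (fun y hy => (Finset.mem_product.1 (hY hy)).1)
    rw [h1]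
    push_cast
    refine Finset.sum_congr rfl fun t _ => ?_
    congr 1
    refine Finset.card_nbij' Prod.snd (fun z => (t, z)) ?_ ?_ ?_ ?_
    · rintro ⟨a, b⟩ h
      simp only [Finset.coe_filter, Set.mem_ofPred_eq] at h ⊢
      obtain ⟨h, rfl⟩ := h
      exact ⟨(Finset.mem_product.1 (hY h)).2, h⟩
    · intro z h
      simp only [Finset.coe_filter, Set.mem_ofPred_eq] at h ⊢
      exact ⟨h.2, trivial⟩
    · rintro ⟨a, b⟩ h
      simp only [Finset.coe_filter, Set.mem_ofPred_eq] at h ⊢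
      rw [h.2]
    · intro z _
      rfl
  -- The coordinates are treated one at a time, with ground sets `C₂ × C₃ × X`, then `C₃ × X`, then
  -- `X`; the surviving elements of one round are the dense relation of the next.
  obtain ⟨A₁, hA₁, ha₁, Y₁, hY₁, hy₁, hG₁⟩ := H₁ C₁ (C₂ ×ˢ (C₃ ×ˢ X))
    (fun h y => G h y.1 y.2.1 y.2.2) hc₁ (by
      have : ∀ h ∈ C₁, p * ((C₂ ×ˢ (C₃ ×ˢ X)).card : ℝ)
          ≤ (((C₂ ×ˢ (C₃ ×ˢ X)).filter fun y => G h y.1 y.2.1 y.2.2).card : ℝ) := by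
        intro h hh
        rw [slice C₂ (C₃ ×ˢ X) _ (Finset.filter_subset _ _)]
        have h1 : ∀ s ∈ C₂, p * ((C₃ ×ˢ X).card : ℝ) ≤ (((C₃ ×ˢ X).filter fun z =>
            (s, z) ∈ (C₂ ×ˢ (C₃ ×ˢ X)).filter fun y => G h y.1 y.2.1 y.2.2).card : ℝ) := by
          intro s hs
          rw [Finset.filter_congr (q := fun z => G h s z.1 z.2) (by
            intro z hz
            simp only [Finset.mem_filter, Finset.mem_product] at hz ⊢
            tauto)]
          rw [slice C₃ X _ (Finset.filter_subset _ _)]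
          have h2 : ∀ k ∈ C₃, p * (X.card : ℝ) ≤ ((X.filter fun x =>
              (k, x) ∈ (C₃ ×ˢ X).filter fun z => G h s z.1 z.2).card : ℝ) := by
            intro k hk
            rw [Finset.filter_congr (q := G h s k) (by
              intro x hx
              simp only [Finset.mem_filter, Finset.mem_product]
              tauto)]
            exact hG h (hC₁ hh) s (hC₂ hs) k (hC₃ hk)
          refine le_trans (le_of_eq ?_) (Finset.sum_le_sum h2)
          rw [Finset.sum_const, nsmul_eq_mul, Finset.card_product]
          push_cast; ring
        refine le_trans (le_of_eq ?_) ((Finset.sum_le_sum h1).trans (le_of_eq (by congr!)))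
        rw [Finset.sum_const, nsmul_eq_mul, Finset.card_product C₂]
        push_cast; ring
      refine le_trans (le_of_eq ?_) (Finset.sum_le_sum this)
      rw [Finset.sum_const, nsmul_eq_mul, hc₁]
      ring)
  obtain ⟨A₂, hA₂, ha₂, Y₂, hY₂, hy₂, hG₂⟩ := H₂ C₂ (C₃ ×ˢ X) (fun s y => (s, y) ∈ Y₁) hc₂ (by
    rw [← slice C₂ (C₃ ×ˢ X) Y₁ hY₁]
    refine le_trans (le_of_eq ?_) hy₁
    rw [Finset.card_product C₂, hc₂]
    push_cast; ring)
  obtain ⟨A₃, hA₃, ha₃, Y₃, hY₃, hy₃, hG₃⟩ := H₃ C₃ X (fun k x => (k, x) ∈ Y₂) hc₃ (by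
    rw [← slice C₃ X Y₂ hY₂]
    refine le_trans (le_of_eq ?_) hy₂
    rw [Finset.card_product C₃, hc₃]
    push_cast; ring)
  have hX0 : 0 < (X.card : ℝ) := by exact_mod_cast hX.card_pos
  have hY3 : 0 < Y₃.card := by
    have : 0 < (Y₃.card : ℝ) := lt_of_lt_of_le (by positivity) hy₃
    exact_mod_cast this
  obtain ⟨x, hx⟩ := Finset.card_pos.1 hY3
  refine ⟨A₁, hA₁.trans hC₁, A₂, hA₂.trans hC₂, A₃, hA₃.trans hC₃, ha₁, ha₂, ha₃, x, hY₃ hx,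
    fun h hh s hs k hk => ?_⟩
  exact hG₁ _ (hG₂ _ (hG₃ x hx k hk) s hs) h hh

theorem Finset.exists_mem_card_lt_card_gt {I : Type*} [LinearOrder I] (S : Finset I) (a b : ℕ)
    (h : a + b + 1 ≤ S.card) :
    ∃ x ∈ S, a ≤ (S.filter (· < x)).card ∧ b ≤ (S.filter (x < ·)).card := by
  induction a generalizing S with
  | zero =>
    have hne : S.Nonempty := Finset.card_pos.1 (by omega)
    refine ⟨S.min' hne, S.min'_mem hne, by simp, ?_⟩
    have : S.erase (S.min' hne) ⊆ S.filter (S.min' hne < ·) := fun y hy => by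
      rw [Finset.mem_erase] at hy
      exact Finset.mem_filter.2 ⟨hy.2, lt_of_le_of_ne (S.min'_le y hy.2) hy.1.symm⟩
    have := Finset.card_le_card this
    rw [Finset.card_erase_of_mem (S.min'_mem hne)] at this
    omega
  | succ a ih =>
    have hne : S.Nonempty := Finset.card_pos.1 (by omega)
    have hm := S.min'_mem hne
    obtain ⟨x, hx, h1, h2⟩ := ih (S.erase (S.min' hne))
      (by rw [Finset.card_erase_of_mem hm]; omega)
    have hxS := Finset.mem_of_mem_erase hx
    refine ⟨x, hxS, ?_, h2.trans (Finset.card_le_card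
      (Finset.filter_subset_filter _ (Finset.erase_subset _ _)))⟩
    have hlt : S.min' hne < x :=
      lt_of_le_of_ne (S.min'_le x hxS) (Finset.ne_of_mem_erase hx).symm
    rw [Finset.filter_erase, Finset.card_erase_of_mem (Finset.mem_filter.2 ⟨hm, hlt⟩)] at h1
    have : 0 < (S.filter (· < x)).card := Finset.card_pos.2 ⟨_, Finset.mem_filter.2 ⟨hm, hlt⟩⟩
    omega

theorem Finset.card_filter_lt_strictMono {I : Type*} [LinearOrder I] (A : Finset I) {x y : I}
    (hx : x ∈ A) (hxy : x < y) : (A.filter (· < x)).card < (A.filter (· < y)).card := by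
  refine Finset.card_lt_card (Finset.ssubset_iff_of_subset ?_ |>.2 ⟨x, ?_, ?_⟩)
  · intro z hz
    rw [Finset.mem_filter] at hz ⊢
    exact ⟨hz.1, hz.2.trans hxy⟩
  · exact Finset.mem_filter.2 ⟨hx, hxy⟩
  · simp

theorem Finset.eq_of_card_filter_lt_eq {I : Type*} [LinearOrder I] (A : Finset I) {x y : I}
    (hx : x ∈ A) (hy : y ∈ A) (h : (A.filter (· < x)).card = (A.filter (· < y)).card) :
    x = y := by
  rcases lt_trichotomy x y with hxy | rfl | hxy
  · exact absurd h (A.card_filter_lt_strictMono hx hxy).ne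
  · rfl
  · exact absurd h (A.card_filter_lt_strictMono hy hxy).ne'

/-- Simultaneous selection: if for all `h < i < s < j < k` a positive proportion of `part i j` is
good for `h, i, s, j, k`, then after passing to a subset of the indices one vertex of each
`part i j` is good for all `h, s, k`. -/
theorem exists_selection (p : ℝ) (hp : 0 < p) (M : ℕ) (hM : 2 ≤ M) : ∃ N : ℕ,
    ∀ (I : Type) [LinearOrder I] (S : Finset I), N ≤ S.card →
    ∀ {V : Type*} (part : I → I → Finset V) (Good : I → I → I → I → I → V → Prop)
      [∀ h i s j k, DecidablePred (Good h i s j k)],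
      (∀ i ∈ S, ∀ j ∈ S, i < j → (part i j).Nonempty) →
      (∀ h ∈ S, ∀ i ∈ S, ∀ s ∈ S, ∀ j ∈ S, ∀ k ∈ S, h < i → i < s → s < j → j < k →
        p * (part i j).card ≤ (((part i j).filter (Good h i s j k)).card : ℝ)) →
      ∃ T ⊆ S, T.card = M ∧ ∃ w : I → I → V, ∀ i ∈ T, ∀ j ∈ T, i < j → w i j ∈ part i j ∧
        ∀ h ∈ T, ∀ s ∈ T, ∀ k ∈ T, h < i → i < s → s < j → j < k → Good h i s j k (w i j) := by
  classical
  obtain ⟨q, hq⟩ := exists_common_of_box p hp M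
  -- The colour of an `M`-set records which pairs of ranks have a common good vertex within the set.
  -- By homogeneity one successful `M`-set per pair of ranks suffices. The size leaves room for `q`
  -- indices below `i`, between `i` and `j`, and above `j`.
  obtain ⟨N, hN⟩ := exists_homogeneous (Fin M → Fin M → Prop) M (q + (q + q + 1) + 1 + M)
  refine ⟨N, fun I _ S hS V part Good _ hne hgood => ?_⟩
  let ok : Finset I → I → I → Prop := fun A i j => ∃ w ∈ part i j, ∀ h ∈ A, ∀ s ∈ A, ∀ k ∈ A,
    h < i → i < s → s < j → j < k → Good h i s j k w
  obtain ⟨T₀, hT₀, hT₀c, c, hc⟩ := hN I S hS fun A u v => ∀ i ∈ A, ∀ j ∈ A, i < j →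
    (A.filter (· < i)).card = u → (A.filter (· < j)).card = v → ok A i j
  have key : ∀ u v : Fin M, c u v := by
    intro u v
    by_cases huv : u < v
    · obtain ⟨i, hi, hi1, hi2⟩ := T₀.exists_mem_card_lt_card_gt q (q + q + 1) (by omega)
      obtain ⟨j, hj, hj1, hj2⟩ :=
        (T₀.filter (i < ·)).exists_mem_card_lt_card_gt q q (by omega)
      have hij : i < j := (Finset.mem_filter.1 hj).2
      have hjT : j ∈ T₀ := (Finset.mem_filter.1 hj).1
      obtain ⟨A₁, hA₁, A₂, hA₂, A₃, hA₃, h₁, h₂, h₃, w, hw, hG⟩ := hq (T₀.filter (· < i))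
        ((T₀.filter (i < ·)).filter (· < j)) ((T₀.filter (i < ·)).filter (j < ·)) (part i j)
        (fun h s k => Good h i s j k) (hne i (hT₀ hi) j (hT₀ hjT) hij) hi1 hj1 hj2 (by
          intro h hh s hs k hk
          simp only [Finset.mem_filter] at hh hs hk
          exact hgood h (hT₀ hh.1) i (hT₀ hi) s (hT₀ hs.1.1) j (hT₀ hjT) k (hT₀ hk.1.1)
            hh.2 hs.1.2 hs.2 hk.2)
      have huv' : (u : ℕ) < v := huv
      obtain ⟨C₁, hC₁, hc₁⟩ := Finset.exists_subset_card_eq (show (u : ℕ) ≤ A₁.card by omega)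
      obtain ⟨C₂, hC₂, hc₂⟩ := Finset.exists_subset_card_eq
        (show (v : ℕ) - u - 1 ≤ A₂.card by omega)
      obtain ⟨C₃, hC₃, hc₃⟩ := Finset.exists_subset_card_eq
        (show M - 1 - (v : ℕ) ≤ A₃.card by omega)
      have l₁ : ∀ x ∈ C₁, x ∈ T₀ ∧ x < i := fun x hx => by
        simpa using hA₁ (hC₁ hx)
      have l₂ : ∀ x ∈ C₂, (x ∈ T₀ ∧ i < x) ∧ x < j := fun x hx => by
        simpa using hA₂ (hC₂ hx)
      have l₃ : ∀ x ∈ C₃, (x ∈ T₀ ∧ i < x) ∧ j < x := fun x hx => by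
        simpa using hA₃ (hC₃ hx)
      -- The sizes of `C₁`, `C₂`, `C₃` give `i` rank `u` and `j` rank `v` in a set of `M` elements.
      set A := C₁ ∪ (insert i (C₂ ∪ (insert j C₃))) with hA
      have mA : ∀ x, x ∈ A ↔ x ∈ C₁ ∨ x = i ∨ x ∈ C₂ ∨ x = j ∨ x ∈ C₃ := by
        intro x
        simp only [hA, Finset.mem_union, Finset.mem_insert]
      have hAT : A ⊆ T₀ := by
        intro x hx
        rcases (mA x).1 hx with h | rfl | h | rfl | h
        · exact (l₁ x h).1
        · exact hi
        · exact (l₂ x h).1.1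
        · exact hjT
        · exact (l₃ x h).1.1
      have f₁ : A.filter (· < i) = C₁ := by
        ext x
        rw [Finset.mem_filter, mA]
        constructor
        · rintro ⟨h | rfl | h | rfl | h, hx⟩
          · exact h
          · exact absurd hx (lt_irrefl _)
          · exact absurd hx (l₂ x h).1.2.not_gt
          · exact absurd hx hij.not_gt
          · exact absurd hx (l₃ x h).1.2.not_gt
        · exact fun h => ⟨Or.inl h, (l₁ x h).2⟩
      have f₂ : A.filter (· < j) = C₁ ∪ insert i C₂ := by
        ext x
        rw [Finset.mem_filter, mA, Finset.mem_union, Finset.mem_insert]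
        constructor
        · rintro ⟨h | rfl | h | rfl | h, hx⟩
          · exact Or.inl h
          · exact Or.inr (Or.inl rfl)
          · exact Or.inr (Or.inr h)
          · exact absurd hx (lt_irrefl _)
          · exact absurd hx (l₃ x h).2.not_gt
        · rintro (h | rfl | h)
          · exact ⟨Or.inl h, (l₁ x h).2.trans hij⟩
          · exact ⟨Or.inr (Or.inl rfl), hij⟩
          · exact ⟨Or.inr (Or.inr (Or.inl h)), (l₂ x h).2⟩
      have cA₂ : (C₁ ∪ insert i C₂).card = v := by
        rw [Finset.card_union_of_disjoint, Finset.card_insert_of_notMem, hc₁, hc₂]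
        · omega
        · exact fun h => lt_irrefl _ (l₂ i h).1.2
        · rw [Finset.disjoint_left]
          intro x hx hx'
          rcases Finset.mem_insert.1 hx' with rfl | h
          · exact lt_irrefl _ (l₁ x hx).2
          · exact lt_asymm (l₁ x hx).2 (l₂ x h).1.2
      have cA : A.card = M := by
        have hA' : A = (C₁ ∪ insert i C₂) ∪ insert j C₃ := by
          ext x; rw [mA]; simp only [Finset.mem_union, Finset.mem_insert]; tauto
        have hv := v.2
        rw [hA', Finset.card_union_of_disjoint, Finset.card_insert_of_notMem, cA₂, hc₃]
        · omega
        · exact fun h => lt_irrefl _ (l₃ j h).2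
        · rw [Finset.disjoint_left]
          intro x hx hx'
          rw [← f₂, Finset.mem_filter] at hx
          rcases Finset.mem_insert.1 hx' with rfl | h
          · exact lt_irrefl _ hx.2
          · exact lt_asymm hx.2 (l₃ x h).2
      rw [← hc A hAT cA]
      intro i' hi' j' hj' _ hu hv
      have e1 : i' = i := A.eq_of_card_filter_lt_eq hi' ((mA i).2 (by tauto))
        (by rw [hu, f₁, hc₁])
      have e2 : j' = j := A.eq_of_card_filter_lt_eq hj' ((mA j).2 (by tauto))
        (by rw [hv, f₂, cA₂])
      rw [e1, e2]
      refine ⟨w, hw, fun h hh s hs k hk hhi his hsj hjk => hG h ?_ s ?_ k ?_⟩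
      · exact hC₁ (f₁ ▸ Finset.mem_filter.2 ⟨hh, hhi⟩)
      · have := (f₂ ▸ Finset.mem_filter.2 ⟨hs, hsj⟩ : s ∈ C₁ ∪ insert i C₂)
        rw [Finset.mem_union, Finset.mem_insert] at this
        rcases this with h' | rfl | h'
        · exact absurd his (l₁ s h').2.not_gt
        · exact absurd his (lt_irrefl _)
        · exact hC₂ h'
      · rcases (mA k).1 hk with h' | rfl | h' | rfl | h'
        · exact absurd ((l₁ k h').2.trans hij) hjk.not_gt
        · exact absurd hij hjk.not_gt
        · exact absurd (l₂ k h').2 hjk.not_gt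
        · exact absurd hjk (lt_irrefl _)
        · exact hC₃ h'
    -- No pair `i < j` has ranks `u ≥ v`, so this colour holds vacuously.
    · obtain ⟨A, hA, hAc⟩ := Finset.exists_subset_card_eq (show M ≤ T₀.card by omega)
      rw [← hc A hA hAc]
      intro i hi j _ hij hu hv
      have := A.card_filter_lt_strictMono hi hij
      rw [hu, hv] at this
      exact absurd this huv
  obtain ⟨T, hT, hTc⟩ := Finset.exists_subset_card_eq (show M ≤ T₀.card by omega)
  refine ⟨T, hT.trans hT₀, hTc, ?_⟩
  have hsel : ∀ i ∈ T, ∀ j ∈ T, i < j → ok T i j := by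
    intro i hi j hj hij
    have rk : ∀ x ∈ T, (T.filter (· < x)).card < M := fun x hx => by
      rw [← hTc]
      exact Finset.card_lt_card (Finset.filter_ssubset.2 ⟨x, hx, lt_irrefl x⟩)
    have := key ⟨_, rk i hi⟩ ⟨_, rk j hj⟩
    rw [← hc T hT hTc] at this
    exact this i hi j hj hij rfl rfl
  have : Nonempty V := by
    obtain ⟨x, hx, y, hy, hxy⟩ := Finset.one_lt_card.1 (show 1 < T.card by omega)
    rcases lt_or_gt_of_ne hxy with h | h
    · exact ⟨(hsel x hx y hy h).choose⟩
    · exact ⟨(hsel y hy x hx h).choose⟩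
  refine ⟨fun i j => if h : ok T i j then h.choose else Classical.arbitrary V,
    fun i hi j hj hij => ?_⟩
  have h := hsel i hi j hj hij
  simp only [dif_pos h]
  exact h.choose_spec

/-! ### Weighted densities and the transfer of weight to single vertices. -/

/-- The weighted sum of `e` over the triples in `A × B × C`. -/
noncomputable def tripleSum {V : Type*} (A B C : Finset V) (e : V → V → V → ℝ)
    (x y z : V → ℝ) : ℝ :=
  ∑ a ∈ A, ∑ b ∈ B, ∑ c ∈ C, x a * y b * z c * e a b c

/-- Multilinearity. The vertices are chosen so as to control the coefficient of `t`; the higher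
coefficients are treated as error terms. -/
theorem tripleSum_add_smul {V : Type*} (A B C : Finset V) (e : V → V → V → ℝ)
    (x y z x' y' z' : V → ℝ) (t : ℝ) :
    tripleSum A B C e (x + t • x') (y + t • y') (z + t • z') =
      tripleSum A B C e x y z
        + t * (tripleSum A B C e x' y z + tripleSum A B C e x y' z + tripleSum A B C e x y z')
        + t ^ 2 * (tripleSum A B C e x y' z' + tripleSum A B C e x' y z'
          + tripleSum A B C e x' y' z)
        + t ^ 3 * tripleSum A B C e x' y' z' := by
  simp only [tripleSum, Pi.add_apply, Pi.smul_apply, smul_eq_mul, Finset.mul_sum,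
    ← Finset.sum_add_distrib]
  refine Finset.sum_congr rfl fun a _ => Finset.sum_congr rfl fun b _ =>
    Finset.sum_congr rfl fun c _ => ?_
  ring

theorem abs_tripleSum_le {V : Type*} (A B C : Finset V) (e : V → V → V → ℝ)
    (he : ∀ a b c, 0 ≤ e a b c ∧ e a b c ≤ 1) (x y z : V → ℝ) :
    |tripleSum A B C e x y z| ≤ (∑ a ∈ A, |x a|) * (∑ b ∈ B, |y b|) * (∑ c ∈ C, |z c|) := by
  rw [Finset.sum_mul_sum, Finset.sum_mul]
  refine (Finset.abs_sum_le_sum_abs _ _).trans (Finset.sum_le_sum fun a _ => ?_)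
  rw [Finset.sum_mul]
  refine (Finset.abs_sum_le_sum_abs _ _).trans (Finset.sum_le_sum fun b _ => ?_)
  rw [Finset.mul_sum]
  refine (Finset.abs_sum_le_sum_abs _ _).trans (Finset.sum_le_sum fun c _ => ?_)
  rw [abs_mul, abs_mul, abs_mul, abs_of_nonneg (he a b c).1]
  exact mul_le_of_le_one_right (by positivity) (he a b c).2

/-- The uniform weight on `X`. -/
noncomputable def uniformWeight {V : Type*} (X : Finset V) : V → ℝ := fun _ => (X.card : ℝ)⁻¹

/-- The difference of the point mass at `w` and the uniform weight on `X`. -/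
noncomputable def pointShift {V : Type*} [DecidableEq V] (X : Finset V) (w : V) : V → ℝ :=
  Pi.single w 1 - uniformWeight X

theorem sum_pointShift_mul {V : Type*} [DecidableEq V] (X : Finset V) (g : V → ℝ)
    {w : V} (hw : w ∈ X) :
    ∑ a ∈ X, pointShift X w a * g a = g w - (X.card : ℝ)⁻¹ * ∑ a ∈ X, g a := by
  simp only [pointShift, uniformWeight, Pi.sub_apply, sub_mul, Finset.sum_sub_distrib,
    Finset.mul_sum]
  congr 1
  rw [Finset.sum_eq_single w (fun b _ hb => by simp [hb]) (fun h => absurd hw h)]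
  simp

/-- The average of the point masses is the uniform weight, so to first order moving weight to a
random vertex costs nothing on average. -/
theorem sum_sum_pointShift_mul {V : Type*} [DecidableEq V] (X : Finset V) (hX : X.Nonempty)
    (g : V → ℝ) : ∑ w ∈ X, ∑ a ∈ X, pointShift X w a * g a = 0 := by
  rw [Finset.sum_congr rfl fun w hw => sum_pointShift_mul X g hw, Finset.sum_sub_distrib,
    Finset.sum_const, nsmul_eq_mul, ← mul_assoc, mul_inv_cancel₀, one_mul, sub_self]
  exact_mod_cast hX.card_pos.ne'

theorem sum_abs_pointShift_le {V : Type*} [DecidableEq V] (X : Finset V) {w : V} (hw : w ∈ X) :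
    ∑ a ∈ X, |pointShift X w a| ≤ 2 := by
  have h : ∀ a ∈ X, |pointShift X w a| ≤ Pi.single (M := fun _ => ℝ) w 1 a + (X.card : ℝ)⁻¹ := by
    intro a _
    have h0 : (0 : ℝ) ≤ Pi.single (M := fun _ => ℝ) w 1 a := by
      by_cases h : a = w
      · subst h; simp
      · simp [h]
    have h1 : (0 : ℝ) ≤ (X.card : ℝ)⁻¹ := by positivity
    simp only [pointShift, uniformWeight, Pi.sub_apply]
    rw [abs_le]
    constructor <;> linarith
  refine (Finset.sum_le_sum h).trans (le_of_eq ?_)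
  rw [Finset.sum_add_distrib, Finset.sum_const, nsmul_eq_mul, mul_inv_cancel₀,
    Finset.sum_eq_single w (fun b _ hb => by simp [hb]) (fun h => absurd hw h)]
  · simp; norm_num
  · exact_mod_cast (Finset.card_pos.2 ⟨w, hw⟩).ne'

theorem sum_tripleSum_pointShift_left {V : Type*} [DecidableEq V] (A B C : Finset V)
    (hA : A.Nonempty) (e : V → V → V → ℝ) (y z : V → ℝ) :
    ∑ w ∈ A, tripleSum A B C e (pointShift A w) y z = 0 := by
  rw [← sum_sum_pointShift_mul A hA fun a => ∑ b ∈ B, ∑ c ∈ C, y b * z c * e a b c]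
  refine Finset.sum_congr rfl fun w _ => Finset.sum_congr rfl fun a _ => ?_
  simp only [Finset.mul_sum, mul_assoc]

theorem sum_tripleSum_pointShift_right {V : Type*} [DecidableEq V] (A B C : Finset V)
    (hB : B.Nonempty) (e : V → V → V → ℝ) (x z : V → ℝ) :
    ∑ w ∈ B, tripleSum A B C e x (pointShift B w) z = 0 := by
  rw [← sum_sum_pointShift_mul B hB fun b => ∑ a ∈ A, ∑ c ∈ C, x a * z c * e a b c]
  refine Finset.sum_congr rfl fun w _ => ?_
  rw [tripleSum, Finset.sum_comm]
  refine Finset.sum_congr rfl fun b _ => ?_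
  simp only [Finset.mul_sum]
  refine Finset.sum_congr rfl fun a _ => Finset.sum_congr rfl fun c _ => ?_
  ring

theorem sum_tripleSum_pointShift_top {V : Type*} [DecidableEq V] (A B C : Finset V)
    (hC : C.Nonempty) (e : V → V → V → ℝ) (x y : V → ℝ) :
    ∑ w ∈ C, tripleSum A B C e x y (pointShift C w) = 0 := by
  rw [← sum_sum_pointShift_mul C hC fun c => ∑ a ∈ A, ∑ b ∈ B, x a * y b * e a b c]
  refine Finset.sum_congr rfl fun w _ => ?_
  rw [tripleSum, Finset.sum_congr rfl fun a _ => Finset.sum_comm, Finset.sum_comm]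
  refine Finset.sum_congr rfl fun c _ => ?_
  simp only [Finset.mul_sum]
  refine Finset.sum_congr rfl fun a _ => Finset.sum_congr rfl fun b _ => ?_
  ring

/-- A function with vanishing sum is not much below zero on a positive proportion of its domain. -/
theorem mul_card_le_card_filter_of_sum_eq_zero {V : Type*} (X : Finset V) (f : V → ℝ)
    (η b : ℝ) (hη : 0 < η) (hb : 0 < b) (hsum : ∑ w ∈ X, f w = 0) (hf : ∀ w ∈ X, f w ≤ b)
    [DecidablePred fun w => -η ≤ f w] :
    η / (b + η) * X.card ≤ ((X.filter fun w => -η ≤ f w).card : ℝ) := by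
  have h1 : ∑ w ∈ X, f w ≤ ∑ w ∈ X, ((if -η ≤ f w then b + η else 0) - η) := by
    refine Finset.sum_le_sum fun w hw => ?_
    split_ifs with h
    · have := hf w hw; linarith
    · linarith [not_le.1 h]
  rw [hsum, Finset.sum_sub_distrib, ← Finset.sum_filter] at h1
  simp only [Finset.sum_const, nsmul_eq_mul] at h1
  rw [div_mul_eq_mul_div, div_le_iff₀ (by positivity)]
  linarith

/-- The mixture of the point masses at `φ 0, …, φ (m - 1)`, each with weight `t`, and the uniform
weight on `X`. -/
noncomputable def blend {V : Type*} [DecidableEq V] (X : Finset V) (t : ℝ) (m : ℕ) (φ : ℕ → V) :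
    V → ℝ :=
  fun a => (∑ c ∈ Finset.range m, t * Pi.single (M := fun _ => ℝ) (φ c) 1 a)
    + (1 - m * t) * uniformWeight X a

theorem blend_zero {V : Type*} [DecidableEq V] (X : Finset V) (t : ℝ) (φ : ℕ → V) :
    blend X t 0 φ = uniformWeight X := by
  ext a; simp [blend]

theorem blend_succ {V : Type*} [DecidableEq V] (X : Finset V) (t : ℝ) (m : ℕ) (φ : ℕ → V) :
    blend X t (m + 1) φ = blend X t m φ + t • pointShift X (φ m) := by
  ext a
  simp only [blend, Finset.sum_range_succ, pointShift, Pi.add_apply, Pi.smul_apply, Pi.sub_apply,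
    smul_eq_mul]
  push_cast
  ring

theorem blend_congr {V : Type*} [DecidableEq V] (X : Finset V) (t : ℝ) (m : ℕ) (φ ψ : ℕ → V)
    (h : ∀ c < m, φ c = ψ c) : blend X t m φ = blend X t m ψ := by
  ext a
  simp only [blend]
  congr 1
  exact Finset.sum_congr rfl fun c hc => by rw [h c (Finset.mem_range.1 hc)]

theorem sum_abs_blend {V : Type*} [DecidableEq V] (X : Finset V) (hX : X.Nonempty) (t : ℝ)
    (ht : 0 ≤ t) (m : ℕ) (hm : m * t ≤ 1) (φ : ℕ → V) (hφ : ∀ c < m, φ c ∈ X) :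
    ∑ a ∈ X, |blend X t m φ a| = 1 := by
  have h0 : ∀ a, 0 ≤ blend X t m φ a := by
    intro a
    refine add_nonneg (Finset.sum_nonneg fun c _ => mul_nonneg ht ?_)
      (mul_nonneg (by linarith) (by simp [uniformWeight]))
    by_cases h : a = φ c
    · subst h; simp
    · simp [h]
  simp only [abs_of_nonneg (h0 _)]
  simp only [blend, uniformWeight, Finset.sum_add_distrib, Finset.sum_const, nsmul_eq_mul]
  rw [Finset.sum_comm]
  have h1 : ∀ c ∈ Finset.range m,
      ∑ a ∈ X, t * Pi.single (M := fun _ => ℝ) (φ c) 1 a = t := by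
    intro c hc
    rw [Finset.sum_eq_single (φ c) (fun b _ hb => by simp [hb])
      (fun h => absurd (hφ c (Finset.mem_range.1 hc)) h)]
    simp
  rw [Finset.sum_congr rfl h1, Finset.sum_const, Finset.card_range, nsmul_eq_mul]
  have : (X.card : ℝ) ≠ 0 := by exact_mod_cast hX.card_pos.ne'
  field_simp
  ring

/-- The blended density of the triad `i, j, k`. -/
noncomputable def blendSum {I V : Type*} [DecidableEq V] (part : I → I → Finset V)
    (e : I → I → I → V → V → V → ℝ) (t : ℝ) (m : ℕ) (φ : I → I → ℕ → V) (i j k : I) : ℝ :=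
  tripleSum (part i j) (part j k) (part i k) (e i j k) (blend (part i j) t m (φ i j))
    (blend (part j k) t m (φ j k)) (blend (part i k) t m (φ i k))

/-- Rounding turns reals in [-2, 2] into finitely many Ramsey colours at the price of an error 1/M;
the cap `4 * M` is never exceeded there. -/
theorem le_add_inv_of_floor_eq {M : ℕ} (hM : 0 < M) {x y : ℝ} (hx : |x| ≤ 2) (hy : |y| ≤ 2)
    (h : min ⌊M * (x + 2)⌋₊ (4 * M) = min ⌊M * (y + 2)⌋₊ (4 * M)) : x - (M : ℝ)⁻¹ ≤ y := by
  have hM' : (0 : ℝ) < M := by exact_mod_cast hM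
  have aux : ∀ z : ℝ, |z| ≤ 2 → ⌊M * (z + 2)⌋₊ ≤ 4 * M := by
    intro z hz
    refine Nat.floor_le_of_le ?_
    push_cast
    nlinarith [(abs_le.1 hz).2]
  rw [min_eq_left (aux x hx), min_eq_left (aux y hy)] at h
  have h1 : (⌊M * (y + 2)⌋₊ : ℝ) ≤ M * (y + 2) :=
    Nat.floor_le (mul_nonneg hM'.le (by linarith [(abs_le.1 hy).1]))
  have h2 : M * (x + 2) < ⌊M * (x + 2)⌋₊ + 1 := Nat.lt_floor_add_one _
  rw [h] at h2
  have h3 : (M : ℝ) * x - 1 ≤ M * y := by linarith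
  have h4 : (M : ℝ) * (x - (M : ℝ)⁻¹) ≤ M * y := by
    rw [mul_sub, mul_inv_cancel₀ hM'.ne']; exact h3
  exact le_of_mul_le_mul_left h4 hM'

theorem Finset.exists_increasing_five {I : Type*} [LinearOrder I] (T : Finset I)
    (hT : 5 ≤ T.card) : ∃ h ∈ T, ∃ i ∈ T, ∃ s ∈ T, ∃ j ∈ T, ∃ k ∈ T,
      h < i ∧ i < s ∧ s < j ∧ j < k := by
  obtain ⟨T', hT', hc⟩ := Finset.exists_subset_card_eq hT
  let f := T'.orderEmbOfFin hc
  have hf : ∀ x, f x ∈ T := fun x => hT' (T'.orderEmbOfFin_mem hc x)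
  exact ⟨f 0, hf 0, f 1, hf 1, f 2, hf 2, f 3, hf 3, f 4, hf 4,
    f.strictMono (by decide), f.strictMono (by decide), f.strictMono (by decide),
    f.strictMono (by decide)⟩

/-- One can choose `m` vertices in each part such that replacing a share `m / M` of the uniform
weights by their point masses does not decrease the densities by more than `24 m / M ^ 2`. -/
theorem exists_blendSum_ge (M : ℕ) (hM : 0 < M) (d : ℝ) (m : ℕ) (hm : m ≤ M) : ∀ K : ℕ, ∃ N : ℕ,
    ∀ (I : Type) [LinearOrder I] (S : Finset I), N ≤ S.card →
    ∀ {V : Type*} [DecidableEq V] [Nonempty V] (part : I → I → Finset V)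
      (e : I → I → I → V → V → V → ℝ),
      (∀ i j k a b c, 0 ≤ e i j k a b c ∧ e i j k a b c ≤ 1) →
      (∀ i ∈ S, ∀ j ∈ S, i < j → (part i j).Nonempty) →
      (∀ i ∈ S, ∀ j ∈ S, ∀ k ∈ S, i < j → j < k → d ≤ tripleSum (part i j) (part j k) (part i k)
        (e i j k) (uniformWeight (part i j)) (uniformWeight (part j k))
        (uniformWeight (part i k))) →
      ∃ T ⊆ S, T.card = K ∧ ∃ φ : I → I → ℕ → V,
        (∀ i ∈ T, ∀ j ∈ T, i < j → ∀ c < m, φ i j c ∈ part i j) ∧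
        ∀ i ∈ T, ∀ j ∈ T, ∀ k ∈ T, i < j → j < k →
          d - m * (24 * (M : ℝ)⁻¹ ^ 2) ≤ blendSum part e (M : ℝ)⁻¹ m φ i j k := by
  classical
  induction m with
  | zero =>
    intro K
    refine ⟨K, fun I _ S hS V _ _ part e he hne hd => ?_⟩
    obtain ⟨T, hT, hc⟩ := Finset.exists_subset_card_eq hS
    refine ⟨T, hT, hc, fun _ _ _ => Classical.arbitrary V, by simp, fun i hi j hj k hk hij hjk => ?_⟩
    simpa [blendSum, blend_zero] using hd i (hT hi) j (hT hj) k (hT hk) hij hjk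
  | succ m ih =>
    intro K
    set η : ℝ := (M : ℝ)⁻¹ with hη
    have hM' : (0 : ℝ) < M := by exact_mod_cast hM
    have hη0 : 0 < η := by positivity
    have hη1 : η ≤ 1 := inv_le_one_of_one_le₀ (by exact_mod_cast hM)
    have hmη : m * η ≤ 1 := by
      rw [hη, ← div_eq_mul_inv, div_le_one hM']
      exact_mod_cast (by omega : m ≤ M)
    obtain ⟨N₁, h₁⟩ := exists_homogeneous_triples
      (Fin (4 * M + 1) × Fin (4 * M + 1) × Fin (4 * M + 1)) (K + 5)
    obtain ⟨N₂, h₂⟩ := exists_selection (η / (6 + η)) (by positivity) (N₁ + 2) (by omega)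
    obtain ⟨N₃, h₃⟩ := ih (by omega) N₂
    refine ⟨N₃, fun I _ S hS V _ _ part e he hne hd => ?_⟩
    obtain ⟨T₁, hT₁, hc₁, φ, hφ, hφd⟩ := h₃ I S hS part e he hne hd
    let ν : I → I → V → ℝ := fun i j => blend (part i j) η m (φ i j)
    let ξ : I → I → V → V → ℝ := fun i j w => pointShift (part i j) w
    -- First-order effects on the triad `i, j, k` of moving weight to `w` as its left, right or top
    -- vertex.
    let L : I → I → I → V → ℝ := fun i j k w => tripleSum (part i j) (part j k) (part i k)
      (e i j k) (ξ i j w) (ν j k) (ν i k)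
    let R : I → I → I → V → ℝ := fun i j k w => tripleSum (part i j) (part j k) (part i k)
      (e i j k) (ν i j) (ξ j k w) (ν i k)
    let U : I → I → I → V → ℝ := fun i j k w => tripleSum (part i j) (part j k) (part i k)
      (e i j k) (ν i j) (ν j k) (ξ i k w)
    have hν : ∀ i ∈ T₁, ∀ j ∈ T₁, i < j → ∑ a ∈ part i j, |ν i j a| = 1 :=
      fun i hi j hj hij => sum_abs_blend _ (hne i (hT₁ hi) j (hT₁ hj) hij) η hη0.le m hmη _
        (hφ i hi j hj hij)
    have hξ : ∀ i j, ∀ w ∈ part i j, ∑ a ∈ part i j, |ξ i j w a| ≤ 2 :=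
      fun i j w hw => sum_abs_pointShift_le _ hw
    have hξ0 : ∀ i j w, 0 ≤ ∑ a ∈ part i j, |ξ i j w a| :=
      fun i j w => Finset.sum_nonneg fun _ _ => abs_nonneg _
    have bL : ∀ i ∈ T₁, ∀ j ∈ T₁, ∀ k ∈ T₁, i < j → j < k → ∀ w ∈ part i j, |L i j k w| ≤ 2 := by
      intro i hi j hj k hk hij hjk w hw
      refine (abs_tripleSum_le _ _ _ _ (he i j k) _ _ _).trans ?_
      rw [hν j hj k hk hjk, hν i hi k hk (hij.trans hjk), mul_one, mul_one]
      exact hξ i j w hw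
    have bR : ∀ i ∈ T₁, ∀ j ∈ T₁, ∀ k ∈ T₁, i < j → j < k → ∀ w ∈ part j k, |R i j k w| ≤ 2 := by
      intro i hi j hj k hk hij hjk w hw
      refine (abs_tripleSum_le _ _ _ _ (he i j k) _ _ _).trans ?_
      rw [hν i hi j hj hij, hν i hi k hk (hij.trans hjk), one_mul, mul_one]
      exact hξ j k w hw
    have bU : ∀ i ∈ T₁, ∀ j ∈ T₁, ∀ k ∈ T₁, i < j → j < k → ∀ w ∈ part i k, |U i j k w| ≤ 2 := by
      intro i hi j hj k hk hij hjk w hw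
      refine (abs_tripleSum_le _ _ _ _ (he i j k) _ _ _).trans ?_
      rw [hν i hi j hj hij, hν j hj k hk hjk, one_mul, one_mul]
      exact hξ i k w hw
    -- The pair `i < j` is left in `i, j, k`, right in `h, i, j` and top in `i, s, j`. Each of the
    -- three terms has mean zero and is at most 2, whence the bound 6 and the proportion `η / (6 +
    -- η)`.
    obtain ⟨T₂, hT₂, hc₂, w, hw⟩ := h₂ I T₁ hc₁.ge part
      (fun h i s j k w => -η ≤ L i j k w + R h i j w + U i s j w)
      (fun i hi j hj hij => hne i (hT₁ hi) j (hT₁ hj) hij) (by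
        intro h hh i hi s hs j hj k hk hhi his hsj hjk
        have hij := his.trans hsj
        have hn := hne i (hT₁ hi) j (hT₁ hj) hij
        refine mul_card_le_card_filter_of_sum_eq_zero (part i j)
          (fun w => L i j k w + R h i j w + U i s j w) η 6 hη0 (by norm_num) ?_ ?_
        · rw [Finset.sum_add_distrib, Finset.sum_add_distrib,
            sum_tripleSum_pointShift_left _ _ _ hn, sum_tripleSum_pointShift_right _ _ _ hn,
            sum_tripleSum_pointShift_top _ _ _ hn]
          norm_num
        · intro w hw
          have h1 := (abs_le.1 (bL i hi j hj k hk hij hjk w hw)).2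
          have h2 := (abs_le.1 (bR h hh i hi j hj hhi hij w hw)).2
          have h3 := (abs_le.1 (bU i hi s hs j hj his hsj w hw)).2
          linarith)
    let col : ℝ → Fin (4 * M + 1) := fun x =>
      ⟨min ⌊M * (x + 2)⌋₊ (4 * M), Nat.lt_succ_of_le (min_le_right _ _)⟩
    obtain ⟨T₃, hT₃, hc₃, ⟨c₁, c₂, c₃⟩, hcol⟩ := h₁ I T₂ (by omega) fun i j k =>
      (col (L i j k (w i j)), col (R i j k (w j k)), col (U i j k (w i k)))
    -- A reference chain. At the pair `t₁, t₃` the three terms, taken from three different triads,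
    -- sum to at least `-η`; by homogeneity the terms of any single triad differ from them by at
    -- most `η` each, which gives `-(4 * η)`.
    obtain ⟨t₀, m₀, t₁, m₁, t₂, m₂, t₃, m₃, t₄, m₄, l₁, l₂, l₃, l₄⟩ :=
      T₃.exists_increasing_five (by omega)
    have l₁₃ := l₂.trans l₃
    have g : ∀ x ∈ T₃, x ∈ T₂ := fun x hx => hT₃ hx
    have g' : ∀ x ∈ T₃, x ∈ T₁ := fun x hx => hT₂ (hT₃ hx)
    have hwp : ∀ i ∈ T₃, ∀ j ∈ T₃, i < j → w i j ∈ part i j := fun i hi j hj hij =>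
      (hw i (g i hi) j (g j hj) hij).1
    have hbase := (hw t₁ (g _ m₁) t₃ (g _ m₃) l₁₃).2 t₀ (g _ m₀) t₂ (g _ m₂) t₄ (g _ m₄)
      l₁ l₂ l₃ l₄
    have hcol' : ∀ i ∈ T₃, ∀ j ∈ T₃, ∀ k ∈ T₃, i < j → j < k → col (L i j k (w i j)) = c₁ ∧
        col (R i j k (w j k)) = c₂ ∧ col (U i j k (w i k)) = c₃ := by
      intro i hi j hj k hk hij hjk
      have := hcol i hi j hj k hk hij hjk
      simpa only [Prod.mk.injEq] using this
    have hcolval : ∀ {x y : ℝ}, |x| ≤ 2 → |y| ≤ 2 → col x = col y → x - η ≤ y :=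
      fun hx hy h => le_add_inv_of_floor_eq hM hx hy (congrArg Fin.val h)
    have hfirst : ∀ i ∈ T₃, ∀ j ∈ T₃, ∀ k ∈ T₃, i < j → j < k →
        -(4 * η) ≤ L i j k (w i j) + R i j k (w j k) + U i j k (w i k) := by
      intro i hi j hj k hk hij hjk
      have hik := hij.trans hjk
      have a1 := hcolval (bL t₁ (g' _ m₁) t₃ (g' _ m₃) t₄ (g' _ m₄) l₁₃ l₄ _ (hwp _ m₁ _ m₃ l₁₃))
        (bL i (g' _ hi) j (g' _ hj) k (g' _ hk) hij hjk _ (hwp _ hi _ hj hij))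
        ((hcol' t₁ m₁ t₃ m₃ t₄ m₄ l₁₃ l₄).1.trans (hcol' i hi j hj k hk hij hjk).1.symm)
      have a2 := hcolval (bR t₀ (g' _ m₀) t₁ (g' _ m₁) t₃ (g' _ m₃) l₁ l₁₃ _ (hwp _ m₁ _ m₃ l₁₃))
        (bR i (g' _ hi) j (g' _ hj) k (g' _ hk) hij hjk _ (hwp _ hj _ hk hjk))
        ((hcol' t₀ m₀ t₁ m₁ t₃ m₃ l₁ l₁₃).2.1.trans (hcol' i hi j hj k hk hij hjk).2.1.symm)
      have a3 := hcolval (bU t₁ (g' _ m₁) t₂ (g' _ m₂) t₃ (g' _ m₃) l₂ l₃ _ (hwp _ m₁ _ m₃ l₁₃))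
        (bU i (g' _ hi) j (g' _ hj) k (g' _ hk) hij hjk _ (hwp _ hi _ hk hik))
        ((hcol' t₁ m₁ t₂ m₂ t₃ m₃ l₂ l₃).2.2.trans (hcol' i hi j hj k hk hij hjk).2.2.symm)
      linarith
    obtain ⟨T, hT, hTc⟩ := Finset.exists_subset_card_eq (show K ≤ T₃.card by omega)
    refine ⟨T, ((hT.trans hT₃).trans hT₂).trans hT₁, hTc,
      fun i j => Function.update (φ i j) m (w i j), ?_, ?_⟩
    · intro i hi j hj hij c hc
      beta_reduce
      rcases eq_or_ne c m with rfl | hcm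
      · rw [Function.update_self]
        exact hwp i (hT hi) j (hT hj) hij
      · rw [Function.update_of_ne hcm]
        exact hφ i (g' _ (hT hi)) j (g' _ (hT hj)) hij c (by omega)
    · intro i hi j hj k hk hij hjk
      have hik := hij.trans hjk
      have hb : ∀ i j, blend (part i j) η (m + 1) (Function.update (φ i j) m (w i j))
          = ν i j + η • ξ i j (w i j) := by
        intro i j
        rw [blend_succ, Function.update_self, blend_congr (part i j) η m _ (φ i j)
          fun c hc => Function.update_of_ne hc.ne _ _]
      have hi' := hT hi
      have hj' := hT hj
      have hk' := hT hk
      have hf := hfirst i hi' j hj' k hk' hij hjk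
      have h0 := hφd i (g' _ hi') j (g' _ hj') k (g' _ hk') hij hjk
      rw [blendSum] at h0
      rw [blendSum, hb, hb, hb, tripleSum_add_smul]
      have nij := hν i (g' _ hi') j (g' _ hj') hij
      have njk := hν j (g' _ hj') k (g' _ hk') hjk
      have nik := hν i (g' _ hi') k (g' _ hk') hik
      have xij := hξ i j _ (hwp i hi' j hj' hij)
      have xjk := hξ j k _ (hwp j hj' k hk' hjk)
      have xik := hξ i k _ (hwp i hi' k hk' hik)
      have yij := hξ0 i j (w i j)
      have yjk := hξ0 j k (w j k)
      have yik := hξ0 i k (w i k)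
      have b1 := abs_tripleSum_le (part i j) (part j k) (part i k) (e i j k) (he i j k)
        (ν i j) (ξ j k (w j k)) (ξ i k (w i k))
      have b2 := abs_tripleSum_le (part i j) (part j k) (part i k) (e i j k) (he i j k)
        (ξ i j (w i j)) (ν j k) (ξ i k (w i k))
      have b3 := abs_tripleSum_le (part i j) (part j k) (part i k) (e i j k) (he i j k)
        (ξ i j (w i j)) (ξ j k (w j k)) (ν i k)
      have b4 := abs_tripleSum_le (part i j) (part j k) (part i k) (e i j k) (he i j k)
        (ξ i j (w i j)) (ξ j k (w j k)) (ξ i k (w i k))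
      rw [nij, one_mul] at b1
      rw [njk, mul_one] at b2
      rw [nik, mul_one] at b3
      have c1 := (abs_le.1 (b1.trans (mul_le_mul xjk xik yik (by norm_num)))).1
      have c2 := (abs_le.1 (b2.trans (mul_le_mul xij xik yik (by norm_num)))).1
      have c3 := (abs_le.1 (b3.trans (mul_le_mul xij xjk yjk (by norm_num)))).1
      have c4 := (abs_le.1 (b4.trans (mul_le_mul (mul_le_mul xij xjk yjk (by norm_num)) xik yik
        (by norm_num)))).1
      -- The loss is `4 * η ^ 2` from the linear term, `12 * η ^ 2` from three quadratic terms
      -- bounded by 4, and `8 * η ^ 3` from the cubic term.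
      have s1 := mul_le_mul_of_nonneg_left hf hη0.le
      have s2 := mul_le_mul_of_nonneg_left (add_le_add (add_le_add c1 c2) c3) (sq_nonneg η)
      have s3 := mul_le_mul_of_nonneg_left c4 (pow_nonneg hη0.le 3)
      have s4 : η ^ 3 ≤ η ^ 2 := pow_le_pow_of_le_one hη0.le hη1 (by norm_num)
      simp only [L, R, U] at s1
      push_cast
      linarith

/-! ### Extraction of a palette. -/

theorem tripleSum_eq {V : Type*} (A B C : Finset V) (e : V → V → V → ℝ) (x y z : V → ℝ) :
    tripleSum A B C e x y z = ∑ a ∈ A, x a * ∑ b ∈ B, y b * ∑ c ∈ C, z c * e a b c := by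
  simp only [tripleSum, Finset.mul_sum, mul_assoc]

/-- With `m * t = 1` no uniform weight is left, so weighted sums become averages over the chosen
vertices. -/
theorem sum_blend_mul {V : Type*} [DecidableEq V] (X : Finset V) (t : ℝ) (m : ℕ)
    (hm : m * t = 1) (φ : ℕ → V) (hφ : ∀ c < m, φ c ∈ X) (g : V → ℝ) :
    ∑ a ∈ X, blend X t m φ a * g a = ∑ c ∈ Finset.range m, t * g (φ c) := by
  simp only [blend, hm, sub_self, zero_mul, add_zero, Finset.sum_mul]
  rw [Finset.sum_comm]
  refine Finset.sum_congr rfl fun c hc => ?_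
  rw [Finset.sum_eq_single (φ c) (fun b _ hb => by simp [hb])
    (fun h => absurd (hφ c (Finset.mem_range.1 hc)) h)]
  simp

/-- Palettes suffice: in a sufficiently large partitioned hypergraph whose triads have density at
least `d > d'`, finitely many vertices ("colours") can be selected in each of the parts of a
subset of the indices such that all triads look the same on the selected vertices, with density
at least `d'`. -/
theorem exists_palette (d d' : ℝ) (hd : d' < d) (K : ℕ) (hK : 3 ≤ K) :
    ∃ N M : ℕ, 0 < M ∧ ∀ (I : Type) [LinearOrder I] (S : Finset I), N ≤ S.card →
    ∀ {V : Type*} [DecidableEq V] [Nonempty V] (part : I → I → Finset V)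
      (E : I → I → I → V → V → V → Prop) [∀ i j k a b c, Decidable (E i j k a b c)],
      (∀ i ∈ S, ∀ j ∈ S, i < j → (part i j).Nonempty) →
      (∀ i ∈ S, ∀ j ∈ S, ∀ k ∈ S, i < j → j < k →
        d * ((part i j).card * (part j k).card * (part i k).card) ≤
          (((part i j ×ˢ part j k ×ˢ part i k).filter
            fun t => E i j k t.1 t.2.1 t.2.2).card : ℝ)) →
      ∃ T ⊆ S, T.card = K ∧ ∃ (φ : I → I → Fin M → V) (P : Fin M → Fin M → Fin M → Prop),
        (∀ i ∈ T, ∀ j ∈ T, i < j → ∀ c, φ i j c ∈ part i j) ∧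
        (∀ i ∈ T, ∀ j ∈ T, ∀ k ∈ T, i < j → j < k → ∀ a b c,
          P a b c ↔ E i j k (φ i j a) (φ j k b) (φ i k c)) ∧
        d' * (M : ℝ) ^ 3 ≤ Nat.card {t : Fin M × Fin M × Fin M // P t.1 t.2.1 t.2.2} := by
  classical
  -- The `M` rounds lose `24 / M` in total, which has to stay below `d - d'`.
  obtain ⟨M, hM⟩ := exists_nat_gt (max (24 / (d - d')) 0)
  have hM0 : (0 : ℝ) < M := (le_max_right _ _).trans_lt hM
  have hM1 : 24 / (d - d') < M := (le_max_left _ _).trans_lt hM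
  have hMn : 0 < M := by exact_mod_cast hM0
  obtain ⟨N₁, h₁⟩ := exists_homogeneous_triples (Fin M → Fin M → Fin M → Prop) K
  obtain ⟨N, hN⟩ := exists_blendSum_ge M hMn d M le_rfl N₁
  refine ⟨N, M, hMn, fun I _ S hS V _ _ part E _ hne hden => ?_⟩
  let e : I → I → I → V → V → V → ℝ := fun i j k a b c => if E i j k a b c then 1 else 0
  obtain ⟨T₁, hT₁, hc₁, φ, hφ, hφd⟩ := hN I S hS part e
    (fun i j k a b c => by simp only [e]; split_ifs <;> norm_num) hne (by
      intro i hi j hj k hk hij hjk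
      have h := hden i hi j hj k hk hij hjk
      have p1 : (0 : ℝ) < (part i j).card := by exact_mod_cast (hne i hi j hj hij).card_pos
      have p2 : (0 : ℝ) < (part j k).card := by exact_mod_cast (hne j hj k hk hjk).card_pos
      have p3 : (0 : ℝ) < (part i k).card := by
        exact_mod_cast (hne i hi k hk (hij.trans hjk)).card_pos
      have hcount : (((part i j ×ˢ part j k ×ˢ part i k).filter
          fun t => E i j k t.1 t.2.1 t.2.2).card : ℝ) =
          ∑ a ∈ part i j, ∑ b ∈ part j k, ∑ c ∈ part i k, e i j k a b c := by
        rw [Finset.card_filter, Finset.sum_product]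
        push_cast
        refine Finset.sum_congr rfl fun a _ => ?_
        rw [Finset.sum_product]
      rw [hcount, ← le_div_iff₀ (by positivity)] at h
      refine h.trans (le_of_eq ?_)
      simp only [tripleSum, uniformWeight, ← Finset.mul_sum]
      rw [div_eq_inv_mul, mul_inv, mul_inv])
  -- The Ramsey colour of a triple is the whole edge pattern on the chosen vertices; the common
  -- colour is the palette.
  obtain ⟨T, hT, hTc, P, hP⟩ := h₁ I T₁ hc₁.ge fun i j k a b c =>
    E i j k (φ i j a) (φ j k b) (φ i k c)
  refine ⟨T, hT.trans hT₁, hTc, fun i j c => φ i j c, P, ?_, ?_, ?_⟩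
  · exact fun i hi j hj hij c => hφ i (hT hi) j (hT hj) hij c c.2
  · intro i hi j hj k hk hij hjk a b c
    rw [← hP i hi j hj k hk hij hjk]
  · obtain ⟨i, hi, j, hj, k, hk, hij, hjk⟩ : ∃ i ∈ T, ∃ j ∈ T, ∃ k ∈ T, i < j ∧ j < k := by
      obtain ⟨T', hT', hc⟩ := Finset.exists_subset_card_eq (hK.trans hTc.ge)
      let f := T'.orderEmbOfFin hc
      have hf : ∀ x, f x ∈ T := fun x => hT' (T'.orderEmbOfFin_mem hc x)
      exact ⟨f 0, hf 0, f 1, hf 1, f 2, hf 2, f.strictMono (by decide),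
        f.strictMono (by decide)⟩
    have h := hφd i (hT hi) j (hT hj) k (hT hk) hij hjk
    have hMi : (M : ℝ) * (M : ℝ)⁻¹ = 1 := mul_inv_cancel₀ hM0.ne'
    rw [blendSum, tripleSum_eq] at h
    simp only [sum_blend_mul _ _ _ hMi _ (hφ i (hT hi) j (hT hj) hij),
      sum_blend_mul _ _ _ hMi _ (hφ j (hT hj) k (hT hk) hjk),
      sum_blend_mul _ _ _ hMi _ (hφ i (hT hi) k (hT hk) (hij.trans hjk))] at h
    simp only [← Finset.mul_sum, Finset.sum_range] at h
    have hcard : ((Nat.card {t : Fin M × Fin M × Fin M // P t.1 t.2.1 t.2.2} : ℕ) : ℝ)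
        = ∑ a : Fin M, ∑ b : Fin M, ∑ c : Fin M,
          e i j k (φ i j a) (φ j k b) (φ i k c) := by
      rw [Nat.card_eq_fintype_card, Fintype.card_subtype, Finset.card_filter,
        Fintype.sum_prod_type]
      push_cast
      refine Finset.sum_congr rfl fun a _ => ?_
      rw [Fintype.sum_prod_type]
      refine Finset.sum_congr rfl fun b _ => Finset.sum_congr rfl fun c _ => ?_
      have hc := congrFun (congrFun (congrFun (hP i hi j hj k hk hij hjk) a) b) c
      simp only [e]
      by_cases h : P a b c
      · rw [if_pos h, if_pos (by rw [hc]; exact h)]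
      · rw [if_neg h, if_neg (by rw [hc]; exact h)]
    rw [← hcard] at h
    set Z : ℝ := ((Nat.card {t : Fin M × Fin M × Fin M // P t.1 t.2.1 t.2.2} : ℕ) : ℝ)
    have h2 : d' ≤ d - M * (24 * (M : ℝ)⁻¹ ^ 2) := by
      rw [div_lt_iff₀ (by linarith)] at hM1
      have : (M : ℝ) * (24 * (M : ℝ)⁻¹ ^ 2) = 24 / M := by field_simp
      rw [this]
      have : 24 / (M : ℝ) ≤ d - d' := by rw [div_le_iff₀ hM0]; linarith
      linarith
    have h3 := h2.trans h
    have h4 : (M : ℝ)⁻¹ * ((M : ℝ)⁻¹ * ((M : ℝ)⁻¹ * Z)) = Z / (M : ℝ) ^ 3 := by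
      field_simp
    rw [h4, le_div_iff₀ (by positivity)] at h3
    exact h3

/-! ### The real inequalities behind 4/27. -/

/-- The difference of the two sides is affine in `(a, c)` on the triangle `a + c ≤ l`, so its three
vertices suffice: `v0`, `v1`, `v2` are the vertex bounds, recombined with weights `l - a - c`, `a`,
`c`. -/
theorem cross_le (l r o a b p c d q Y : ℝ) (hrl : r ≤ l)
    (ha : 0 ≤ a) (hb : 0 ≤ b) (hp : 0 ≤ p) (hc : 0 ≤ c) (hd : 0 ≤ d) (hq : 0 ≤ q)
    (hac : a + c ≤ l) (hbd : b + d ≤ r) (hpq : p + q ≤ o)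
    (hY : ∀ p q : ℝ, 0 ≤ p → 0 ≤ q → p + q ≤ o → p * r + q * l + p * q ≤ Y) :
    l * (p * (c + d + q) + q * (a + b)) ≤ o * (a * b + c * d + c * b) + l * Y := by
  have h1 := hY p q hp hq hpq
  have h2 := hY q p hq hp (by linarith)
  have hr : 0 ≤ r := by linarith
  have v0 : p * (d + q) + q * b ≤ Y := by nlinarith
  have v1 : p * (d + q) + q * b + (l * q - o * b) ≤ Y := by nlinarith
  have v2 : p * (d + q) + q * b + (l * p - o * (b + d)) ≤ Y := by nlinarith
  have k0 := mul_le_mul_of_nonneg_left v0 (show 0 ≤ l - a - c by linarith)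
  have k1 := mul_le_mul_of_nonneg_left v1 ha
  have k2 := mul_le_mul_of_nonneg_left v2 hc
  nlinarith

/-- The difference of the two sides is `(4 / 3 - x) * (x - 1 / 3) ^ 2`. -/
theorem mul_one_sub_sq_le (x : ℝ) (hx : x ≤ 1) : x * (1 - x) ^ 2 ≤ 4 / 27 := by
  nlinarith [mul_nonneg (show 0 ≤ 4 / 3 - x by linarith) (sq_nonneg (x - 1 / 3))]

/-- The bound in the case that `a` and `d'` are both small, for `1 / 2 ≤ l`. -/
theorem low_bound_of_half_le (l r : ℝ) (hr : 0 < r) (hs : l + r ≤ 1)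
    (hQ : 4 / 27 ≤ l * r) (hl : 1 / 2 ≤ l) :
    (l * r) ^ 2 / (l + r) + (1 - (l + r)) * (l + r) * r - (1 - (l + r)) * (4 / 27) * r / l
      + (l + r) * ((1 - (l + r)) * l) ≤ 4 / 27 := by
  obtain ⟨s, hsdef⟩ : ∃ s, s = l + r := ⟨_, rfl⟩
  rw [← hsdef] at hs ⊢
  have hl0 : 0 < l := by linarith
  have hs0 : 0 < s := by linarith
  have hs1 : 79 / 100 ≤ s := by nlinarith
  have hQs : l * r ≤ (s - 1 / 2) / 2 := by nlinarith
  have h1 : (l * r) ^ 2 / s ≤ ((s - 1 / 2) / 2) ^ 2 / s := by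
    gcongr
  have hmain : ((s - 1 / 2) / 2) ^ 2 / s ≤
      (s - 2 / 3) ^ 2 * (s + 1 / 3) + (1 - s) * (4 / 27) * r / l := by
    rw [div_le_iff₀ hs0]
    -- For small `s` the term with `r / l` is needed, and `4 / 27 ≤ l * r` forces the ratio to be at
    -- least `2 / 5`; for larger `s` the polynomial in `s` suffices.
    rcases le_total s (85 / 100) with h | h
    · have hrl : 2 / 5 ≤ r / l := by
        rw [le_div_iff₀ hl0]
        by_contra! hc
        nlinarith
      have : (1 - s) * (4 / 27) * r / l = (1 - s) * (4 / 27) * (r / l) := by ring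
      rw [this]
      have h2 : (1 - s) * (4 / 27) * (2 / 5) ≤ (1 - s) * (4 / 27) * (r / l) := by gcongr
      have h3 : ((s - 1 / 2) / 2) ^ 2 ≤
          ((s - 2 / 3) ^ 2 * (s + 1 / 3) + (1 - s) * (4 / 27) * (2 / 5)) * s := by
        nlinarith [mul_nonneg (sub_nonneg.2 hs1) (sub_nonneg.2 hs1),
          mul_nonneg (mul_nonneg (sub_nonneg.2 hs1) (sub_nonneg.2 hs1)) (sub_nonneg.2 hs1), sq_nonneg ((s - 79 / 100) ^ 2)]
      nlinarith
    · have h2 : 0 ≤ (1 - s) * (4 / 27) * r / l := by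
        have : 0 ≤ 1 - s := by linarith
        positivity
      have h3 : ((s - 1 / 2) / 2) ^ 2 ≤ ((s - 2 / 3) ^ 2 * (s + 1 / 3)) * s := by
        nlinarith [mul_nonneg (sub_nonneg.2 h) (sub_nonneg.2 h),
          mul_nonneg (mul_nonneg (sub_nonneg.2 h) (sub_nonneg.2 h)) (sub_nonneg.2 h), sq_nonneg ((s - 85 / 100) ^ 2)]
      nlinarith
  have h4 : (1 - s) * s * r + s * ((1 - s) * l) = s ^ 2 * (1 - s) := by rw [hsdef]; ring
  have h5 : s ^ 2 * (1 - s) = 4 / 27 - (s - 2 / 3) ^ 2 * (s + 1 / 3) := by ring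
  linarith

/-- What remains of `low_bound_of_le_half` once the asymmetry `x = l - s / 2` is replaced by its
upper bound `(1 - s) / 2`. The constant `769 / 1000` is just below `√(16 / 27)`, the least sum of
two positive reals with product `4 / 27`. -/
theorem low_polynomial_bound (s : ℝ) (hs1 : 769 / 1000 ≤ s) (hs : s ≤ 1) :
    s ^ 3 / 16 + s * (1 - s) ^ 2 / 4
      + (s / 2 + (1 - s) ^ 2 / 4 * (1000 / 769)) * ((1 - s) / 2) ^ 2
      ≤ (s - 2 / 3) ^ 2 * (s + 1 / 3) + (1 - s) * (4 / 27) := by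
  obtain ⟨u, rfl⟩ : ∃ u, s = 769 / 1000 + u := ⟨s - 769 / 1000, by ring⟩
  have t0 : 0 ≤ u := by linarith
  have t1 : 0 ≤ 231 / 1000 - u := by linarith
  nlinarith [mul_nonneg t0 t1, mul_nonneg (mul_nonneg t0 t0) t1, mul_nonneg (mul_nonneg t0 t1) t1,
    pow_nonneg t0 3]

/-- The bound in the case that `a` and `d'` are both small, for `l ≤ 1 / 2`. -/
theorem low_bound_of_le_half (l r : ℝ) (hrl : r ≤ l) (hr : 0 < r) (hs : l + r ≤ 1)
    (hQ : 4 / 27 ≤ l * r) (hl : l ≤ 1 / 2) :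
    (l * r) ^ 2 / (l + r) + (1 - (l + r)) * (l + r) * r - (1 - (l + r)) * (4 / 27) * r / l
      + (l + r) * ((1 - (l + r)) * l + (1 / 2 - l) ^ 2) ≤ 4 / 27 := by
  obtain ⟨s, hsdef⟩ : ∃ s, s = l + r := ⟨_, rfl⟩
  obtain ⟨x, hx⟩ : ∃ x, x = l - s / 2 := ⟨_, rfl⟩
  have hl' : l = s / 2 + x := by linarith
  have hr' : r = s / 2 - x := by linarith
  have hx0 : 0 ≤ x := by linarith
  have hx1 : x ≤ (1 - s) / 2 := by linarith
  have hl0 : 0 < l := by linarith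
  have hs0 : 0 < s := by linarith
  have hQ' : 4 / 27 ≤ s ^ 2 / 4 - x ^ 2 := by rw [hl', hr'] at hQ; nlinarith
  have hs1 : 769 / 1000 ≤ s := by nlinarith
  rw [← hsdef] at hs ⊢
  have hdiv : 1 - 4 * x / s ≤ r / l := by
    rw [le_div_iff₀ hl0, hl', hr']
    have : (1 - 4 * x / s) * (s / 2 + x) = s / 2 - x - 4 * x ^ 2 / s := by field_simp; ring
    rw [this]
    have : 0 ≤ 4 * x ^ 2 / s := by positivity
    linarith
  have h1 : (l * r) ^ 2 / s = s ^ 3 / 16 - s / 2 * x ^ 2 + x ^ 4 / s := by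
    rw [hl', hr']; field_simp; ring
  have h2 : (1 - s) * (4 / 27) * r / l = (1 - s) * (4 / 27) * (r / l) := by ring
  have h3 : (1 - s) * (4 / 27) * (1 - 4 * x / s) ≤ (1 - s) * (4 / 27) * (r / l) := by
    gcongr
  have h4 : (1 - s) * s * r + s * ((1 - s) * l + (1 / 2 - l) ^ 2)
      = s ^ 2 * (1 - s) + s * ((1 - s) / 2 - x) ^ 2 := by rw [hl', hr']; ring
  have h5 : s ^ 2 * (1 - s) = 4 / 27 - (s - 2 / 3) ^ 2 * (s + 1 / 3) := by ring
  have h6 : x ^ 4 / s ≤ x ^ 2 * (1 - s) ^ 2 / 4 * (1000 / 769) := by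
    rw [div_le_iff₀ hs0]
    have h0 : x ^ 2 ≤ ((1 - s) / 2) ^ 2 := by gcongr
    have h00 : 1 ≤ 1000 / 769 * s := by linarith
    have h01 : x ^ 2 * x ^ 2 ≤ x ^ 2 * ((1 - s) / 2) ^ 2 := by gcongr
    have h02 : x ^ 2 * ((1 - s) / 2) ^ 2 * 1 ≤ x ^ 2 * ((1 - s) / 2) ^ 2 * (1000 / 769 * s) := by
      gcongr
    linarith
  -- The linear term of `s * ((1 - s) / 2 - x) ^ 2` absorbs the loss in `hdiv`, since `16 / 27 ≤ s ^
  -- 2`.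
  have h7 : (4 / 27) * (4 * x / s) ≤ s * x := by
    rw [mul_div_assoc', div_le_iff₀ hs0]
    nlinarith
  have h8 := mul_le_mul_of_nonneg_left h7 (show 0 ≤ 1 - s by linarith)
  rw [h1, h2]
  have h9 : s / 2 * x ^ 2 + x ^ 2 * (1 - s) ^ 2 / 4 * (1000 / 769)
      ≤ (s / 2 + (1 - s) ^ 2 / 4 * (1000 / 769)) * ((1 - s) / 2) ^ 2 := by
    have : x ^ 2 ≤ ((1 - s) / 2) ^ 2 := by gcongr
    have h0 : 0 ≤ s / 2 + (1 - s) ^ 2 / 4 * (1000 / 769) := by positivity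
    nlinarith
  have h10 := low_polynomial_bound s hs1 hs
  linarith

/-- The auxiliary bound `Y` on the contribution of the pairs that meet the third class. -/
theorem exists_cross_bound (l r o : ℝ) (hrl : r ≤ l) (hr : 0 < r) (ho : 0 ≤ o)
    (hsum : l + r + o = 1) (hQ : 4 / 27 ≤ l * r) : ∃ Y : ℝ,
      (∀ p q : ℝ, 0 ≤ p → 0 ≤ q → p + q ≤ o → p * r + q * l + p * q ≤ Y) ∧
      (1 - r) * (l * r) + r * Y ≤ 4 / 27 ∧ (1 - l) * (l * r) + l * Y ≤ 4 / 27 ∧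
      (l * r) ^ 2 / (l + r) + o * (l + r) * r - o * (4 / 27) * r / l + (l + r) * Y ≤ 4 / 27 := by
  have hl : 0 < l := hr.trans_le hrl
  obtain rfl : o = 1 - (l + r) := by linarith
  have h1 := mul_one_sub_sq_le r (by linarith)
  have h2 := mul_nonneg hr.le (sq_nonneg (1 - (l + r)))
  -- On the edge `q = o - p` the form `p * r + q * l + p * q` equals `o * l + (1 - 2 * l) * p - p ^
  -- 2`. It is largest at `p = 0` if `1 / 2 ≤ l` and at `p = 1 / 2 - l` otherwise; `Y` is that
  -- maximum.
  rcases le_total (1 / 2) l with h | h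
  · refine ⟨(1 - (l + r)) * l, fun p q hp hq hpq => ?_, ?_, ?_,
      low_bound_of_half_le l r hr (by linarith) hQ h⟩
    · have m1 := mul_nonneg hp (show 0 ≤ l - r - q by linarith)
      have m2 := mul_nonneg hl.le (show 0 ≤ 1 - (l + r) - p - q by linarith)
      linarith
    · linarith
    · have h3 := mul_one_sub_sq_le (1 - l) (by linarith)
      have h4 := mul_nonneg (mul_nonneg hl.le hr.le) (show 0 ≤ 2 * l - 1 by linarith)
      linarith
  · refine ⟨(1 - (l + r)) * l + (1 / 2 - l) ^ 2, fun p q hp hq hpq => ?_, ?_, ?_,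
      low_bound_of_le_half l r hrl hr (by linarith) hQ h⟩
    · have m1 := mul_nonneg (show 0 ≤ 1 - (l + r) - p - q by linarith)
        (show 0 ≤ l + p by linarith)
      have m2 := sq_nonneg (p - (1 / 2 - l))
      linarith
    · have h3 : (1 / 2 - l) ^ 2 ≤ ((1 - (l + r)) / 2) ^ 2 := by gcongr; linarith
      have h4 := mul_le_mul_of_nonneg_left h3 hr.le
      linarith
    · have h3 := mul_nonneg (mul_nonneg hl.le (show 0 ≤ 1 - 2 * l by linarith))
        (sub_nonneg.2 hrl)
      have h4 : l * (l - 2 * l ^ 2 + 1 / 4) ≤ 4 / 27 := by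
        nlinarith [mul_nonneg hl.le (sq_nonneg (l - 43 / 100)), sq_nonneg (l - 43 / 100)]
      linarith

/-- The numerical core: see `palette_card_le` for the meaning of the variables. -/
theorem density_bound_of_le (l r o D G H F a b p c d q a' b' p' c' d' q' : ℝ)
    (hrl : r ≤ l) (hr : 0 ≤ r) (ho : 0 ≤ o) (hsum : l + r + o = 1)
    (ha : 0 ≤ a) (hb : 0 ≤ b) (hp : 0 ≤ p) (hc : 0 ≤ c) (hd : 0 ≤ d) (hq : 0 ≤ q)
    (ha' : 0 ≤ a') (hb' : 0 ≤ b') (hp' : 0 ≤ p') (hc' : 0 ≤ c') (hd' : 0 ≤ d') (hq' : 0 ≤ q')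
    (hac : a + c ≤ l) (hbd : b + d ≤ r) (hpq : p + q ≤ o)
    (hac' : a' + c' ≤ l) (hbd' : b' + d' ≤ r) (hpq' : p' + q' ≤ o)
    (haa : a + a' ≤ l) (hdd : d + d' ≤ r)
    (hD : D ≤ l * r - a * d')
    (hD₁ : D ≤ l * r - (a * b + c * d + c * b))
    (hD₂ : D ≤ l * r - (a' * b' + c' * d' + c' * b'))
    (hG : G ≤ a * d + (p * (c + d + q) + q * (a + b))) (hGD : G ≤ D)
    (hH : H ≤ a' * d' + (p' * (c' + d' + q') + q' * (a' + b'))) (hHD : H ≤ D)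
    (hF : F ≤ l * G + r * H + o * D) (hFD : F ≤ D) : F ≤ 4 / 27 := by
  by_contra! hcon
  have hDf : 4 / 27 < D := hcon.trans_le hFD
  have hDQ : D ≤ l * r := by linarith [mul_nonneg ha hd']
  have hQ : 4 / 27 < l * r := hDf.trans_le hDQ
  have hl0 : 0 ≤ l := hr.trans hrl
  have hr0 : 0 < r := lt_of_le_of_ne hr fun h => by rw [← h] at hQ; norm_num at hQ
  have hl : 0 < l := hr0.trans_le hrl
  have hs0 : 0 < l + r := by linarith
  have hs1 : l + r ≤ 1 := by linarith
  obtain ⟨Y, hY, hYA, hYB, hYC⟩ := exists_cross_bound l r o hrl hr0 ho hsum hQ.le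
  have hX := cross_le l r o a b p c d q Y hrl ha hb hp hc hd hq hac hbd hpq hY
  have hX' := cross_le l r o a' b' p' c' d' q' Y hrl ha' hb' hp' hc' hd' hq' hac' hbd' hpq' hY
  set X := p * (c + d + q) + q * (a + b)
  set X' := p' * (c' + d' + q') + q' * (a' + b')
  set e := a * b + c * d + c * b
  set e' := a' * b' + c' * d' + c' * b'
  -- If `a` or `d'` is at least `l * r / (l + r)`, then `G` or `H`, respectively, is replaced by
  -- `D`, and the deficit `a * d'` in `hD` absorbs the product `a' * d'` or `a * d` of the other.
  -- Otherwise both products are bounded through `(l * r - a * (l + r)) * (l * r - d' * (l + r)) ≥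
  -- 0`.
  rcases le_total (l * r) (a * (l + r)) with hA | hA
  · -- `a` is large
    have k1 : F ≤ (1 - r) * D + r * H := by
      have : l * G ≤ l * D := by gcongr
      have m4 : (1 - r) * D = l * D + o * D := by
        rw [show 1 - r = l + o by linarith]; ring
      linarith
    have k2 : r * H ≤ r * (a' * d' + X') := by gcongr
    have k3 : r * (l * X') ≤ r * (o * e' + l * Y) := by gcongr
    have k4 : r * o * D ≤ r * o * (l * r - e') := by gcongr
    have m4 : o = 1 - (l + r) := by linarith
    have m5 : 0 ≤ o * (l - r) := mul_nonneg ho (by linarith)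
    have hro : 0 ≤ l * (1 - r) - r * o := by
      have : l * (1 - r) - r * o = l * l + o * (l - r) := by rw [m4]; ring
      rw [this]; positivity
    have k5 := mul_le_mul_of_nonneg_left hD hro
    have k6 : d' * (l * r * a' - (l * (1 - r) - r * o) * a) ≤ 0 := by
      refine mul_nonpos_of_nonneg_of_nonpos hd' ?_
      have m1 : l * r * a' ≤ l * r * (l - a) := by gcongr; linarith
      have m2 : l * (l * r) ≤ l * (a * (l + r)) := by gcongr
      have m3 := mul_nonneg ha m5
      have : l * r * (l - a) - (l * (1 - r) - r * o) * a
          = l * (l * r) - l * (a * (l + r)) - a * (o * (l - r)) := by rw [m4]; ring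
      linarith
    have k7 : l * F ≤ l * ((1 - r) * (l * r) + r * Y) := by
      have := mul_le_mul_of_nonneg_left k1 hl.le
      have := mul_le_mul_of_nonneg_left k2 hl.le
      linarith
    have := le_of_mul_le_mul_left k7 hl
    linarith
  rcases le_total (l * r) (d' * (l + r)) with hB | hB
  · -- `d'` is large
    have k1 : F ≤ (1 - l) * D + l * G := by
      have : r * H ≤ r * D := by gcongr
      have m4 : (1 - l) * D = r * D + o * D := by
        rw [show 1 - l = r + o by linarith]; ring
      linarith
    have k2 : l * G ≤ l * (a * d + X) := by gcongr
    have k4 : o * D ≤ o * (l * r - e) := by gcongr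
    have k5 := mul_le_mul_of_nonneg_left hD hr
    have k6 : a * (l * d - r * d') ≤ 0 := by
      refine mul_nonpos_of_nonneg_of_nonpos ha ?_
      have m1 : l * d ≤ l * (r - d') := by gcongr; linarith
      linarith
    have m4 : (1 - l) * D = r * D + o * D := by
      rw [show 1 - l = r + o by linarith]; ring
    have m5 : (1 - l) * (l * r) = r * (l * r) + o * (l * r) := by
      rw [show 1 - l = r + o by linarith]; ring
    linarith
  · have k1 : l * G ≤ l * (a * d + X) := by gcongr
    have k2 : r * H ≤ r * (a' * d' + X') := by gcongr
    have k3 : l * (a * d) ≤ l * (a * (r - d')) := by gcongr; linarith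
    have k4 : r * (a' * d') ≤ r * ((l - a) * d') := by gcongr; linarith
    have k5 : l * (a * (r - d')) + r * ((l - a) * d') ≤ (l * r) ^ 2 / (l + r) := by
      rw [le_div_iff₀ hs0]
      linarith [mul_nonneg (sub_nonneg.2 hA) (sub_nonneg.2 hB)]
    have j1 : o * e ≤ o * (l * r - D) := by gcongr; linarith
    have j2 : o * e' ≤ o * (l * r - D) := by gcongr; linarith
    have j3 : X ≤ o * (l * r - D) / l + Y := by
      rw [← sub_le_iff_le_add, le_div_iff₀ hl]; linarith
    have j4 : X' ≤ o * (l * r - D) / l + Y := by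
      rw [← sub_le_iff_le_add, le_div_iff₀ hl]; linarith
    have j5 : l * X ≤ l * (o * (l * r - D) / l + Y) := by gcongr
    have j6 : r * X' ≤ r * (o * (l * r - D) / l + Y) := by gcongr
    have j7 : (l + r) * (o * (l * r - D) / l) + o * D = o * (l + r) * r - o * r * (D / l) := by
      field_simp; ring
    have j8 : o * (4 / 27) * r / l ≤ o * r * (D / l) := by
      have : o * r * (4 / 27 / l) ≤ o * r * (D / l) := by gcongr
      calc o * (4 / 27) * r / l = o * r * (4 / 27 / l) := by ring
        _ ≤ _ := this
    linarith

/-- Reversing the order of the indices exchanges `l` with `r`, `G` with `H`, `a` with `d'`, `b` with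
`c'`, and so on, so `r ≤ l` may be assumed. -/
theorem density_bound (l r o D G H F a b p c d q a' b' p' c' d' q' : ℝ)
    (hl : 0 ≤ l) (hr : 0 ≤ r) (ho : 0 ≤ o) (hsum : l + r + o = 1)
    (ha : 0 ≤ a) (hb : 0 ≤ b) (hp : 0 ≤ p) (hc : 0 ≤ c) (hd : 0 ≤ d) (hq : 0 ≤ q)
    (ha' : 0 ≤ a') (hb' : 0 ≤ b') (hp' : 0 ≤ p') (hc' : 0 ≤ c') (hd' : 0 ≤ d') (hq' : 0 ≤ q')
    (hac : a + c ≤ l) (hbd : b + d ≤ r) (hpq : p + q ≤ o)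
    (hac' : a' + c' ≤ l) (hbd' : b' + d' ≤ r) (hpq' : p' + q' ≤ o)
    (haa : a + a' ≤ l) (hdd : d + d' ≤ r)
    (hD : D ≤ l * r - a * d')
    (hD₁ : D ≤ l * r - (a * b + c * d + c * b))
    (hD₂ : D ≤ l * r - (a' * b' + c' * d' + c' * b'))
    (hG : G ≤ a * d + (p * (c + d + q) + q * (a + b))) (hGD : G ≤ D)
    (hH : H ≤ a' * d' + (p' * (c' + d' + q') + q' * (a' + b'))) (hHD : H ≤ D)
    (hF : F ≤ l * G + r * H + o * D) (hFD : F ≤ D) : F ≤ 4 / 27 := by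
  rcases le_total r l with h | h
  · exact density_bound_of_le l r o D G H F a b p c d q a' b' p' c' d' q' h hr ho hsum ha hb hp hc
      hd hq ha' hb' hp' hc' hd' hq' hac hbd hpq hac' hbd' hpq' haa hdd hD hD₁ hD₂ hG hGD hH hHD
      hF hFD
  · exact density_bound_of_le r l o D H G F d' c' q' b' a' p' d c q b a p h hl ho (by linarith)
      hd' hc' hq' hb' ha' hp' hd hc hq hb ha hp (by linarith) (by linarith) (by linarith)
      (by linarith) (by linarith) (by linarith) (by linarith) (by linarith) (by linarith)
      (by linarith) (by linarith) (by linarith) hHD (by linarith) hGD (by linarith) hFD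

/-! ### Counting links in a palette. -/

section Counting

variable {C : Type*} [DecidableEq C]

theorem card_add_mul_le_of_disjoint (L R A B : Finset C) (S : Finset (C × C)) (hS : S ⊆ L ×ˢ R)
    (hAB : ∀ x ∈ A, ∀ y ∈ B, (x, y) ∉ S) :
    S.card + (A ∩ L).card * (B ∩ R).card ≤ L.card * R.card := by
  rw [← Finset.card_product, ← Finset.card_product, ← Finset.card_union_of_disjoint]
  · refine Finset.card_le_card (Finset.union_subset hS ?_)
    exact Finset.product_subset_product Finset.inter_subset_right Finset.inter_subset_right
  · rw [Finset.disjoint_left]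
    rintro ⟨x, y⟩ h h'
    rw [Finset.mem_product, Finset.mem_inter, Finset.mem_inter] at h'
    exact hAB x h'.1.1 y h'.2.1 h

/-- The excluded rectangles `A × A`, `B × B`, `B × A` are pairwise disjoint because `A` and `B` are,
so all three can be subtracted from `L × R`. -/
theorem card_add_three_le_of_disjoint (L R A B : Finset C) (S : Finset (C × C))
    (hS : S ⊆ L ×ˢ R) (hAB : Disjoint A B) (hAA : ∀ x ∈ A, ∀ y ∈ A, (x, y) ∉ S)
    (hBB : ∀ x ∈ B, ∀ y ∈ B, (x, y) ∉ S) (hBA : ∀ x ∈ B, ∀ y ∈ A, (x, y) ∉ S) :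
    S.card + ((A ∩ L).card * (A ∩ R).card + (B ∩ L).card * (B ∩ R).card
      + (B ∩ L).card * (A ∩ R).card) ≤ L.card * R.card := by
  rw [Finset.disjoint_left] at hAB
  have h1 : Disjoint ((A ∩ L) ×ˢ (A ∩ R)) ((B ∩ L) ×ˢ (B ∩ R)) := by
    rw [Finset.disjoint_left]
    rintro ⟨x, y⟩ h h'
    simp only [Finset.mem_product, Finset.mem_inter] at h h'
    exact hAB h.1.1 h'.1.1
  have h2 : Disjoint ((A ∩ L) ×ˢ (A ∩ R) ∪ (B ∩ L) ×ˢ (B ∩ R)) ((B ∩ L) ×ˢ (A ∩ R)) := by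
    rw [Finset.disjoint_left]
    rintro ⟨x, y⟩ h h'
    simp only [Finset.mem_union, Finset.mem_product, Finset.mem_inter] at h h'
    rcases h with h | h
    · exact hAB h.1.1 h'.1.1
    · exact hAB h'.2.1 h.2.1
  simp only [← Finset.card_product]
  rw [← Finset.card_union_of_disjoint h1, ← Finset.card_union_of_disjoint h2,
    ← Finset.card_union_of_disjoint]
  · refine Finset.card_le_card ?_
    rintro ⟨x, y⟩ h
    rw [Finset.mem_union] at h
    rcases h with h | h
    · exact hS h
    · simp only [Finset.mem_union, Finset.mem_product, Finset.mem_inter] at h ⊢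
      tauto
  · rw [Finset.disjoint_left]
    rintro ⟨x, y⟩ h h'
    simp only [Finset.mem_union, Finset.mem_product, Finset.mem_inter] at h'
    rcases h' with (h' | h') | h'
    · exact hAA x h'.1.1 y h'.2.1 h
    · exact hBB x h'.1.1 y h'.2.1 h
    · exact hBA x h'.1.1 y h'.2.1 h

/-- Of the nine blocks formed by `L`, `R`, `O`, only `L × R` and the five that meet `O` can contain
pairs of `S`. -/
theorem card_le_of_forall_mem_or (L R O A B : Finset C) (hLRO : ∀ x, x ∈ L ∨ x ∈ R ∨ x ∈ O)
    (S : Finset (C × C)) (hS : S ⊆ A ×ˢ B) (hLL : ∀ x ∈ L, ∀ y ∈ L, (x, y) ∉ S)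
    (hRR : ∀ x ∈ R, ∀ y ∈ R, (x, y) ∉ S) (hRL : ∀ x ∈ R, ∀ y ∈ L, (x, y) ∉ S) :
    S.card ≤ (A ∩ L).card * (B ∩ R).card
      + ((A ∩ O).card * ((B ∩ L).card + (B ∩ R).card + (B ∩ O).card)
        + (B ∩ O).card * ((A ∩ L).card + (A ∩ R).card)) := by
  have hsub : S ⊆ (A ∩ L) ×ˢ (B ∩ R) ∪ ((A ∩ O) ×ˢ ((B ∩ L) ∪ (B ∩ R) ∪ (B ∩ O))
      ∪ ((A ∩ L) ∪ (A ∩ R)) ×ˢ (B ∩ O)) := by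
    rintro ⟨x, y⟩ h
    obtain ⟨hx, hy⟩ := Finset.mem_product.1 (hS h)
    simp only at hx hy
    simp only [Finset.mem_union, Finset.mem_product, Finset.mem_inter, hx, hy, true_and]
    rcases hLRO x with e1 | e1 | e1 <;> rcases hLRO y with e2 | e2 | e2
    · exact (hLL x e1 y e2 h).elim
    · exact .inl ⟨e1, e2⟩
    · exact .inr (.inr ⟨.inl e1, e2⟩)
    · exact (hRL x e1 y e2 h).elim
    · exact (hRR x e1 y e2 h).elim
    · exact .inr (.inr ⟨.inr e1, e2⟩)
    · exact .inr (.inl ⟨e1, .inl (.inl e2)⟩)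
    · exact .inr (.inl ⟨e1, .inl (.inr e2)⟩)
    · exact .inr (.inl ⟨e1, .inr e2⟩)
  refine (Finset.card_le_card hsub).trans ((Finset.card_union_le _ _).trans ?_)
  rw [Finset.card_product]
  refine Nat.add_le_add_left ((Finset.card_union_le _ _).trans ?_) _
  rw [Finset.card_product, Finset.card_product, mul_comm ((A ∩ L ∪ A ∩ R).card)]
  refine Nat.add_le_add (Nat.mul_le_mul_left _ ?_)
    (Nat.mul_le_mul_left _ (Finset.card_union_le _ _))
  exact (Finset.card_union_le _ _).trans (Nat.add_le_add_right (Finset.card_union_le _ _) _)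

theorem card_inter_add_card_inter_le (A B L : Finset C) (h : Disjoint A B) :
    (A ∩ L).card + (B ∩ L).card ≤ L.card := by
  rw [← Finset.card_union_of_disjoint
    (h.mono Finset.inter_subset_left Finset.inter_subset_left)]
  exact Finset.card_le_card (Finset.union_subset Finset.inter_subset_right
    Finset.inter_subset_right)

end Counting

/-- The integral form of `density_bound`. -/
theorem card_bound (m l r o D G H F a b p c d q a' b' p' c' d' q' : ℕ) (hm : 0 < m)
    (hsum : l + r + o = m)
    (hac : a + c ≤ l) (hbd : b + d ≤ r) (hpq : p + q ≤ o)
    (hac' : a' + c' ≤ l) (hbd' : b' + d' ≤ r) (hpq' : p' + q' ≤ o)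
    (haa : a + a' ≤ l) (hdd : d + d' ≤ r)
    (hD : D + a * d' ≤ l * r)
    (hD₁ : D + (a * b + c * d + c * b) ≤ l * r)
    (hD₂ : D + (a' * b' + c' * d' + c' * b') ≤ l * r)
    (hG : G ≤ a * d + (p * (c + d + q) + q * (a + b))) (hGD : G ≤ D)
    (hH : H ≤ a' * d' + (p' * (c' + d' + q') + q' * (a' + b'))) (hHD : H ≤ D)
    (hF : F ≤ l * G + r * H + o * D) (hFD : F ≤ m * D) :
    (F : ℝ) ≤ 4 / 27 * (m : ℝ) ^ 3 := by
  have hm' : (0 : ℝ) < m := by exact_mod_cast hm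
  obtain ⟨t, ht0, htm⟩ : ∃ t : ℝ, 0 < t ∧ t * m = 1 :=
    ⟨(m : ℝ)⁻¹, by positivity, inv_mul_cancel₀ hm'.ne'⟩
  have lin : ∀ x y w : ℕ, x + y ≤ w → t * (x : ℝ) + t * y ≤ t * w := by
    intro x y w hxy
    have : (x : ℝ) + y ≤ w := by exact_mod_cast hxy
    rw [← mul_add]
    gcongr
  have quad : ∀ x y : ℕ, x ≤ y → t ^ 2 * (x : ℝ) ≤ t ^ 2 * y := fun x y hxy => by gcongr
  have cub : ∀ x y : ℕ, x ≤ y → t ^ 3 * (x : ℝ) ≤ t ^ 3 * y := fun x y hxy => by gcongr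
  have q1 := quad _ _ hD
  have q2 := quad _ _ hD₁
  have q3 := quad _ _ hD₂
  have q4 := quad _ _ hG
  have q5 := quad _ _ hH
  have q6 := cub _ _ hF
  have q7 := cub _ _ hFD
  push_cast at q1 q2 q3 q4 q5 q6 q7
  have hsum' : (l : ℝ) + r + o = m := by exact_mod_cast hsum
  have key := density_bound (t * l) (t * r) (t * o) (t ^ 2 * D) (t ^ 2 * G) (t ^ 2 * H)
    (t ^ 3 * F) (t * a) (t * b) (t * p) (t * c) (t * d) (t * q)
    (t * a') (t * b') (t * p') (t * c') (t * d') (t * q')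
    (by positivity) (by positivity) (by positivity)
    (by rw [← mul_add, ← mul_add, hsum', htm])
    (by positivity) (by positivity) (by positivity) (by positivity) (by positivity)
    (by positivity) (by positivity) (by positivity) (by positivity) (by positivity)
    (by positivity) (by positivity)
    (lin _ _ _ hac) (lin _ _ _ hbd) (lin _ _ _ hpq) (lin _ _ _ hac') (lin _ _ _ hbd')
    (lin _ _ _ hpq') (lin _ _ _ haa) (lin _ _ _ hdd)
    (by linarith) (by linarith) (by linarith) (by linarith) (quad _ _ hGD) (by linarith)
    (quad _ _ hHD) (by linarith)
    (by
      calc t ^ 3 * (F : ℝ) ≤ t ^ 3 * (m * D) := q7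
        _ = t ^ 2 * (t * m) * D := by ring
        _ = t ^ 2 * D := by rw [htm, mul_one])
  have h3 : t ^ 3 * (m : ℝ) ^ 3 = 1 := by rw [← mul_pow, htm, one_pow]
  calc (F : ℝ) = (t ^ 3 * (m : ℝ) ^ 3) * F := by rw [h3, one_mul]
    _ = (t ^ 3 * F) * (m : ℝ) ^ 3 := by ring
    _ ≤ 4 / 27 * (m : ℝ) ^ 3 := by gcongr

/-- A palette, i.e. a set `P` of triples of colours, that contains none of the four configurations
has density at most `4 / 27`. -/
theorem palette_card_le {C : Type*} [Finite C] (P : C → C → C → Prop)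
    (h₁ : ∀ α β γ₀ ω αω γω, P α β γ₀ → P ω β γω → P αω ω γ₀ → False)
    (h₂ : ∀ α β γ₀ ω βω γω, P α β γ₀ → P α ω γω → P ω βω γ₀ → False)
    (h₃ : ∀ α' β' γ₀ αb βb γb, P α' βb γ₀ → P βb αb γb → P αb β' γ₀ → False)
    (h₄ : ∀ αs βs γ γ₁ γ₂ a b a' b' c, P γ₁ βs γ → P αs γ₂ γ → P a b' γ₁ → P a' b γ₂ →
      P a b c → False) :
    (Nat.card {t : C × C × C // P t.1 t.2.1 t.2.2} : ℝ) ≤ 4 / 27 * (Nat.card C : ℝ) ^ 3 := by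
  classical
  have := Fintype.ofFinite C
  let link : C → Finset (C × C) := fun z => Finset.univ.filter fun t => P t.1 t.2 z
  let L : C → Finset C := fun z => Finset.univ.filter fun x => ∃ y, P x y z
  let R : C → Finset C := fun z => Finset.univ.filter fun y => ∃ x, P x y z
  have mlink : ∀ x y z, (x, y) ∈ link z ↔ P x y z := fun x y z => by simp [link]
  have mL : ∀ x z, x ∈ L z ↔ ∃ y, P x y z := fun x z => by simp [L]
  have mR : ∀ y z, y ∈ R z ↔ ∃ x, P x y z := fun y z => by simp [R]
  have hcard : Nat.card {t : C × C × C // P t.1 t.2.1 t.2.2} = ∑ z, (link z).card := by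
    rw [Nat.card_eq_fintype_card, Fintype.card_subtype,
      Finset.card_eq_sum_card_fiberwise (f := fun t => t.2.2) (t := Finset.univ) (by simp)]
    refine Finset.sum_congr rfl fun z _ => ?_
    refine Finset.card_nbij' (fun t => (t.1, t.2.1)) (fun t => (t.1, t.2, z)) ?_ ?_ ?_ ?_
    · rintro ⟨x, y, w⟩ h
      simp only [Finset.coe_filter, Set.mem_ofPred_eq, Finset.mem_filter, Finset.mem_univ,
        true_and, link] at h ⊢
      obtain ⟨h, rfl⟩ := h
      exact h
    · rintro ⟨x, y⟩ h
      simp only [Finset.coe_filter, Set.mem_ofPred_eq, Finset.mem_filter, Finset.mem_univ,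
        true_and, link] at h ⊢
      exact ⟨h, trivial⟩
    · rintro ⟨x, y, w⟩ h
      simp only [Finset.coe_filter, Set.mem_ofPred_eq, Finset.mem_filter, Finset.mem_univ,
        true_and] at h ⊢
      rw [h.2]
    · rintro ⟨x, y⟩ _
      rfl
  rw [hcard, Nat.card_eq_fintype_card]
  by_cases hzero : ∀ z, link z = ∅
  · simp only [hzero, Finset.card_empty, Finset.sum_const_zero, Nat.cast_zero]
    positivity
  push Not at hzero
  obtain ⟨z₀, ⟨x₀, y₀⟩, h₀⟩ := hzero
  obtain ⟨z, -, hz⟩ := Finset.exists_max_image Finset.univ (fun w => (link w).card)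
    ⟨z₀, Finset.mem_univ _⟩
  have hzpos : (link z).Nonempty := by
    rw [← Finset.card_pos]
    exact (Finset.card_pos.2 ⟨_, h₀⟩).trans_le (hz z₀ (Finset.mem_univ _))
  obtain ⟨⟨x₁, y₁⟩, hxy⟩ := hzpos
  rw [mlink] at hxy
  -- Tops in `L z` and `R z` will be compared with `g` and `h`, all other tops with `z`.
  obtain ⟨g, hg, hgmax⟩ := Finset.exists_max_image (L z) (fun w => (link w).card)
    ⟨x₁, (mL _ _).2 ⟨y₁, hxy⟩⟩
  obtain ⟨h, hh, hhmax⟩ := Finset.exists_max_image (R z) (fun w => (link w).card)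
    ⟨y₁, (mR _ _).2 ⟨x₁, hxy⟩⟩
  -- Each forbidden pattern, unpacked, is a rectangle that no link meets.
  have fRR : ∀ w u, ∀ x ∈ R w, ∀ y ∈ R w, (x, y) ∉ link u := by
    intro w u x hx y hy hP
    obtain ⟨s, hs⟩ := (mR _ _).1 hx
    obtain ⟨t, ht⟩ := (mR _ _).1 hy
    exact h₁ _ _ _ _ _ _ ht ((mlink _ _ _).1 hP) hs
  have fLL : ∀ w u, ∀ x ∈ L w, ∀ y ∈ L w, (x, y) ∉ link u := by
    intro w u x hx y hy hP
    obtain ⟨s, hs⟩ := (mL _ _).1 hx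
    obtain ⟨t, ht⟩ := (mL _ _).1 hy
    exact h₂ _ _ _ _ _ _ hs ((mlink _ _ _).1 hP) ht
  have fRL : ∀ w u, ∀ x ∈ R w, ∀ y ∈ L w, (x, y) ∉ link u := by
    intro w u x hx y hy hP
    obtain ⟨s, hs⟩ := (mR _ _).1 hx
    obtain ⟨t, ht⟩ := (mL _ _).1 hy
    exact h₃ _ _ _ _ _ _ hs ((mlink _ _ _).1 hP) ht
  have fgh : ∀ u, ∀ x ∈ L g, ∀ y ∈ R h, (x, y) ∉ link u := by
    intro u x hx y hy hP
    obtain ⟨βs, h1⟩ := (mL _ _).1 hg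
    obtain ⟨αs, h2⟩ := (mR _ _).1 hh
    obtain ⟨s, hs⟩ := (mL _ _).1 hx
    obtain ⟨t, ht⟩ := (mR _ _).1 hy
    exact h₄ _ _ _ _ _ _ _ _ _ _ h1 h2 hs ht ((mlink _ _ _).1 hP)
  have dLR : ∀ w, Disjoint (L w) (R w) := by
    intro w
    rw [Finset.disjoint_left]
    intro x hx hx'
    obtain ⟨y, hy⟩ := (mL _ _).1 hx
    exact fRR w w x hx' y ((mR _ _).2 ⟨x, hy⟩) ((mlink _ _ _).2 hy)
  have linksub : ∀ w, link w ⊆ L w ×ˢ R w := by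
    rintro w ⟨x, y⟩ hP
    rw [mlink] at hP
    exact Finset.mem_product.2 ⟨(mL _ _).2 ⟨y, hP⟩, (mR _ _).2 ⟨x, hP⟩⟩
  set O : Finset C := Finset.univ \ (L z ∪ R z) with hO
  have hLRO : ∀ x, x ∈ L z ∨ x ∈ R z ∨ x ∈ O := by
    intro x
    simp only [hO, Finset.mem_sdiff, Finset.mem_univ, Finset.mem_union, true_and]
    tauto
  have hsum : (L z).card + (R z).card + O.card = Fintype.card C := by
    rw [← Finset.card_union_of_disjoint (dLR z), hO, ← Finset.card_univ, add_comm]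
    exact Finset.card_sdiff_add_card_eq_card (Finset.subset_univ _)
  -- As links avoid `L g × R h`, the link of `g` lies in `L g × B` and that of `h` in `A' × R h`.
  -- Removing the overlaps also gives the disjointness needed for `a + a' ≤ l` and `d + d' ≤ r`.
  set B := R g \ R h with hB
  set A' := L h \ L g with hA'
  have dAB : Disjoint (L g) B := (dLR g).mono_right Finset.sdiff_subset
  have dAB' : Disjoint A' (R h) := (dLR h).mono_left Finset.sdiff_subset
  have dAA : Disjoint (L g) A' := Finset.disjoint_sdiff
  have dBB : Disjoint B (R h) := Finset.sdiff_disjoint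
  have sB : ∀ x ∈ B, x ∈ R g := fun x hx => (Finset.mem_sdiff.1 hx).1
  have sA' : ∀ x ∈ A', x ∈ L h := fun x hx => (Finset.mem_sdiff.1 hx).1
  have n1 := card_add_mul_le_of_disjoint (L z) (R z) (L g) (R h) (link z) (linksub z) (fgh z)
  have n2 := card_add_three_le_of_disjoint (L z) (R z) (L g) B (link z) (linksub z) dAB (fLL g z)
    (fun x hx y hy => fRR g z x (sB x hx) y (sB y hy)) (fun x hx y hy => fRL g z x (sB x hx) y hy)
  have n3 := card_add_three_le_of_disjoint (L z) (R z) A' (R h) (link z) (linksub z) dAB'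
    (fun x hx y hy => fLL h z x (sA' x hx) y (sA' y hy)) (fRR h z)
    (fun x hx y hy => fRL h z x hx y (sA' y hy))
  have n4 := card_le_of_forall_mem_or (L z) (R z) O (L g) B hLRO (link g) (by
    rintro ⟨x, y⟩ hP
    have hP' := Finset.mem_product.1 (linksub g hP)
    exact Finset.mem_product.2 ⟨hP'.1, Finset.mem_sdiff.2
      ⟨hP'.2, fun hy => fgh g x hP'.1 y hy hP⟩⟩) (fLL z g) (fRR z g) (fRL z g)
  have n5 := card_le_of_forall_mem_or (L z) (R z) O A' (R h) hLRO (link h) (by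
    rintro ⟨x, y⟩ hP
    have hP' := Finset.mem_product.1 (linksub h hP)
    exact Finset.mem_product.2 ⟨Finset.mem_sdiff.2
      ⟨hP'.1, fun hx => fgh h x hx y hP'.2 hP⟩, hP'.2⟩) (fLL z h) (fRR z h) (fRL z h)
  have n6 : ∑ w, (link w).card ≤ Fintype.card C * (link z).card := by
    rw [← Finset.card_univ, ← smul_eq_mul]
    exact Finset.sum_le_card_nsmul _ _ _ fun w hw => hz w hw
  have n7 : ∑ w, (link w).card ≤ (L z).card * (link g).card + (R z).card * (link h).card
      + O.card * (link z).card := by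
    rw [← Finset.sum_sdiff (Finset.subset_univ (L z ∪ R z)), Finset.sum_union (dLR z), add_comm]
    simp only [← smul_eq_mul]
    exact add_le_add (add_le_add (Finset.sum_le_card_nsmul _ _ _ hgmax)
      (Finset.sum_le_card_nsmul _ _ _ hhmax))
      (Finset.sum_le_card_nsmul _ _ _ fun w _ => hz w (Finset.mem_univ _))
  have n8 := hz g (Finset.mem_univ _)
  have n9 := hz h (Finset.mem_univ _)
  have i1 := card_inter_add_card_inter_le (L g) B (L z) dAB
  have i2 := card_inter_add_card_inter_le (L g) B (R z) dAB
  have i3 := card_inter_add_card_inter_le (L g) B O dAB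
  have i4 := card_inter_add_card_inter_le A' (R h) (L z) dAB'
  have i5 := card_inter_add_card_inter_le A' (R h) (R z) dAB'
  have i6 := card_inter_add_card_inter_le A' (R h) O dAB'
  have i7 := card_inter_add_card_inter_le (L g) A' (L z) dAA
  have i8 := card_inter_add_card_inter_le B (R h) (R z) dBB
  -- Here `l`, `r`, `o` are the sizes of `L z`, `R z`, `O`, and `D`, `G`, `H` those of the links of
  -- `z`, `g`, `h`. The numbers `a`, `b`, `p` count `L g` inside `L z`, `R z`, `O`, and `c`, `d`,
  -- `q` count `B`; the primed ones count `A'` and `R h` likewise.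
  exact card_bound _ _ _ _ _ _ _ _ _ _ _ _ _ _ _ _ _ _ _ _
    (Fintype.card_pos_iff.2 ⟨z⟩) hsum i1 i2 i3 i4 i5 i6 i7 i8 n1 n2 n3 n4 n8 n5 n9 n7 n6

/-! ### From palettes back to hypergraphs. -/

namespace PartitionedHypergraph

variable {V : Type*} [DecidableEq V] {N : ℕ}

/-- With at least three indices every pair lies in a triad, and a triad with an empty part has
density 0. -/
theorem part_nonempty_of_pos_le_density (H : PartitionedHypergraph V N) (hN : 3 ≤ N) (d : ℝ)
    (hd : 0 < d) (hH : ∀ i j k : Fin N, i < j → j < k → d ≤ H.triadDensity i j k) (i j : Fin N)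
    (hij : i < j) : (H.part i j).Nonempty := by
  have key : ∀ i j k : Fin N, i < j → j < k →
      (H.part i j).Nonempty ∧ (H.part i k).Nonempty ∧ (H.part j k).Nonempty := by
    intro i j k hij hjk
    have h := hd.trans_le (hH i j k hij hjk)
    refine ⟨?_, ?_, ?_⟩ <;>
    · rw [Finset.nonempty_iff_ne_empty]
      intro he
      simp [triadDensity, he] at h
  by_cases h0 : 0 < (i : ℕ)
  · exact (key ⟨0, by omega⟩ i j (Fin.lt_def.2 h0) hij).2.2
  by_cases h1 : (j : ℕ) + 1 < N
  · exact (key i j ⟨j + 1, h1⟩ hij (Fin.lt_def.2 (Nat.lt_succ_self _))).1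
  · have := Fin.lt_def.1 hij
    exact (key i ⟨1, by omega⟩ j (Fin.lt_def.2 (by simp; omega))
      (Fin.lt_def.2 (by simp; omega))).2.1

/-- The triples on the right map onto the triad, so no appeal to the disjointness of the parts is
needed. -/
theorem card_triad_le (H : PartitionedHypergraph V N) (i j k : Fin N) :
    (H.triad i j k).card ≤ ((H.part i j ×ˢ H.part j k ×ˢ H.part i k).filter
      fun t => ({t.1, t.2.1, t.2.2} : Finset V) ∈ H.edges).card := by
  refine (Finset.card_le_card ?_).trans
    (Finset.card_image_le (f := fun t : V × V × V => ({t.1, t.2.1, t.2.2} : Finset V)))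
  intro e he
  obtain ⟨he, a, ha, b, hb, c, hc, rfl⟩ := Finset.mem_filter.1 he
  exact Finset.mem_image.2 ⟨(a, b, c), Finset.mem_filter.2 ⟨Finset.mem_product.2
    ⟨ha, Finset.mem_product.2 ⟨hb, hc⟩⟩, he⟩, rfl⟩

/-- The subhypergraph induced by the index set `{ι 0 < ι 1 < ⋯ < ι (M - 1)}`. -/
def restrict {M : ℕ} (H : PartitionedHypergraph V N) (ι : Fin M ↪o Fin N) :
    PartitionedHypergraph V M where
  part i j := H.part (ι i) (ι j)
  part_disjoint i j k l hij hkl h := H.part_disjoint _ _ _ _ (ι.strictMono hij)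
    (ι.strictMono hkl) fun e => h (by simpa using e)
  edges := H.edges.filter fun e => ∃ i j k : Fin M, i < j ∧ j < k ∧
    ∃ a ∈ H.part (ι i) (ι j), ∃ b ∈ H.part (ι j) (ι k), ∃ c ∈ H.part (ι i) (ι k), e = {a, b, c}
  edges_spec e he := by
    rw [Finset.mem_filter] at he
    exact he.2

theorem restrict_isSubhypergraph {M : ℕ} (H : PartitionedHypergraph V N) (ι : Fin M ↪o Fin N) :
    (H.restrict ι).IsSubhypergraph H ι :=
  ⟨fun _ _ _ => rfl, fun _ he => (Finset.mem_filter.1 he).1⟩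

theorem mem_triad_restrict {M : ℕ} (H : PartitionedHypergraph V N) (ι : Fin M ↪o Fin N)
    {i j k : Fin M} (hij : i < j) (hjk : j < k) {a b c : V} (ha : a ∈ H.part (ι i) (ι j))
    (hb : b ∈ H.part (ι j) (ι k)) (hc : c ∈ H.part (ι i) (ι k)) (h : {a, b, c} ∈ H.edges) :
    {a, b, c} ∈ (H.restrict ι).triad i j k :=
  Finset.mem_filter.2 ⟨Finset.mem_filter.2 ⟨h, i, j, k, hij, hjk, a, ha, b, hb, c, hc, rfl⟩,
    a, ha, b, hb, c, hc, rfl⟩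

/-- A colouring of the parts by a palette `P`: the vertex `φ i j c` is the vertex of colour `c` in
`part i j`, and the triples of colours in `P` are edges in each triad. -/
def IsPaletteColouring {C : Type*} (H : PartitionedHypergraph V N) (P : C → C → C → Prop)
    (φ : Fin N → Fin N → C → V) : Prop :=
  (∀ c, H.IsChoice fun i j => φ i j c) ∧ ∀ i j k : Fin N, i < j → j < k → ∀ a b c, P a b c →
    {φ i j a, φ j k b, φ i k c} ∈ H.triad i j k

section Palette

variable {C : Type*} {H : PartitionedHypergraph V N} {P : C → C → C → Prop}
  {φ : Fin N → Fin N → C → V}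

theorem IsPaletteColouring.mem_edges (hφ : H.IsPaletteColouring P φ) {i j k : Fin N}
    (hij : i < j) (hjk : j < k) {a b c : C} (h : P a b c) :
    {φ i j a, φ j k b, φ i k c} ∈ H.edges :=
  (Finset.mem_filter.1 (hφ.2 i j k hij hjk a b c h)).1

theorem IsPaletteColouring.firstCase (hφ : H.IsPaletteColouring P φ) {α β γ₀ ω αω γω : C}
    (h₁ : P α β γ₀) (h₂ : P ω β γω) (h₃ : P αω ω γ₀) : H.FirstCase :=
  ⟨_, _, _, _, _, _, hφ.1 α, hφ.1 β, hφ.1 γ₀, hφ.1 ω, hφ.1 αω, hφ.1 γω, fun _ _ _ hij hjk =>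
    ⟨hφ.mem_edges hij hjk h₁, hφ.mem_edges hij hjk h₂, hφ.mem_edges hij hjk h₃⟩⟩

theorem IsPaletteColouring.secondCase (hφ : H.IsPaletteColouring P φ) {α β γ₀ ω βω γω : C}
    (h₁ : P α β γ₀) (h₂ : P α ω γω) (h₃ : P ω βω γ₀) : H.SecondCase :=
  ⟨_, _, _, _, _, _, hφ.1 α, hφ.1 β, hφ.1 γ₀, hφ.1 ω, hφ.1 βω, hφ.1 γω, fun _ _ _ hij hjk =>
    ⟨hφ.mem_edges hij hjk h₁, hφ.mem_edges hij hjk h₂, hφ.mem_edges hij hjk h₃⟩⟩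

/-- Taking `α = α'` and `β = βb` makes the first two edges coincide, so three triples suffice; the
bullet vertices depend only on their own part. -/
theorem IsPaletteColouring.thirdCase (hφ : H.IsPaletteColouring P φ) {α' β' γ₀ αb βb γb : C}
    (h₁ : P α' βb γ₀) (h₂ : P βb αb γb) (h₃ : P αb β' γ₀) : H.ThirdCase :=
  ⟨fun i j => φ i j α', fun i j => φ i j βb, fun i j => φ i j α', fun i j => φ i j β',
    fun i j => φ i j γ₀, fun i j => φ i j γb, fun _ j k _ _ => φ j k βb, fun _ _ k s _ => φ k s αb,
    hφ.1 α', hφ.1 βb, hφ.1 α', hφ.1 β', hφ.1 γ₀, hφ.1 γb,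
    fun _ _ _ _ _ _ hjk hks _ => ⟨hφ.1 βb _ _ hjk, hφ.1 αb _ _ hks⟩,
    fun _ _ _ _ _ hij hjk hks hst => ⟨hφ.2 _ _ _ hij hjk _ _ _ h₁, hφ.2 _ _ _ hij hjk _ _ _ h₁,
      hφ.2 _ _ _ hjk hks _ _ _ h₂, hφ.2 _ _ _ hks hst _ _ _ h₃⟩⟩

end Palette

/-- The special vertices are those of colours `a` and `b`, which also serve as `α₁` and `β₂`; of the
special indices only their order matters. -/
theorem IsPaletteColouring.swappedFourthCase {C : Type*} {n : ℕ} (hn : 1 ≤ n)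
    {H : PartitionedHypergraph V (4 * n)} {P : C → C → C → Prop}
    {φ : Fin (4 * n) → Fin (4 * n) → C → V} (hφ : H.IsPaletteColouring P φ)
    {αs βs γ γ₁ γ₂ a b a' b' c : C} (h₁ : P γ₁ βs γ) (h₂ : P αs γ₂ γ) (h₃ : P a b' γ₁)
    (h₄ : P a' b γ₂) (h₅ : P a b c) : H.SwappedFourthCase n hn := by
  refine ⟨_, _, _, _, _, _, _, _, _, hφ.1 αs, hφ.1 βs, hφ.1 γ, hφ.1 a, hφ.1 b', hφ.1 γ₁,
    hφ.1 a', hφ.1 b, hφ.1 γ₂, fun _ _ _ hij hjk =>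
      ⟨hφ.mem_edges hij hjk h₁, hφ.mem_edges hij hjk h₂, hφ.mem_edges hij hjk h₃,
        hφ.mem_edges hij hjk h₄⟩, ?_⟩
  intro iₙ i₂ₙ i₂ₙ₁ i₂ₙ₂ i₃ₙ₁
  have l₁ : iₙ < i₂ₙ₁ := Fin.lt_def.2 (by simp only [iₙ, i₂ₙ₁, idx]; omega)
  have l₂ : i₂ₙ < i₂ₙ₁ := Fin.lt_def.2 (by simp only [i₂ₙ, i₂ₙ₁, idx]; omega)
  have l₃ : i₂ₙ₁ < i₂ₙ₂ := Fin.lt_def.2 (by simp only [i₂ₙ₁, i₂ₙ₂, idx]; omega)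
  have l₄ : i₂ₙ₁ < i₃ₙ₁ := Fin.lt_def.2 (by simp only [i₂ₙ₁, i₃ₙ₁, idx]; omega)
  exact ⟨φ i₂ₙ i₂ₙ₁ a, hφ.1 a _ _ l₂, φ i₂ₙ₁ i₂ₙ₂ b, hφ.1 b _ _ l₃,
    ⟨hφ.1 a _ _ l₂, hφ.1 γ₁ _ _ (l₂.trans l₄), _, hφ.2 _ _ _ l₂ l₄ _ _ _ h₃, by simp, by simp⟩,
    ⟨hφ.1 b _ _ l₃, hφ.1 γ₂ _ _ (l₁.trans l₃), _, hφ.2 _ _ _ l₁ l₃ _ _ _ h₄, by simp, by simp⟩,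
    _, hφ.2 _ _ _ l₂ l₃ _ _ _ h₅, by simp, by simp⟩

end PartitionedHypergraph

theorem mainTheorem6 (δ : ℝ) (hδ : 0 < δ) (n : ℕ) (hn : 1 ≤ n) :
    ∃ N : ℕ, ∀ (V : Type*) [DecidableEq V] (H : PartitionedHypergraph V N),
      ((4 / 27 + δ : ℝ) : EReal) ≤ H.density →
      ∃ (ι : Fin (4 * n) ↪o Fin N) (H₀ : PartitionedHypergraph V (4 * n)),
        H₀.IsSubhypergraph H ι ∧
        (H₀.FirstCase ∨ H₀.SecondCase ∨ H₀.ThirdCase ∨ H₀.SwappedFourthCase n hn) := by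
  obtain ⟨N₀, M, hM, hN₀⟩ := exists_palette (4 / 27 + δ) (4 / 27 + δ / 2) (by linarith) (4 * n)
    (by omega)
  -- Three indices are needed for the density to control every part.
  refine ⟨max N₀ 3, fun V _ H hH => ?_⟩
  rw [H.le_density_iff] at hH
  have hne := H.part_nonempty_of_pos_le_density (le_max_right _ _) _ (by positivity) hH
  have : Nonempty V := (hne ⟨0, by omega⟩ ⟨1, by omega⟩ (Fin.lt_def.2 Nat.zero_lt_one)).to_type
  obtain ⟨T, -, hT, φ, P, hφ, hP, hcard⟩ := hN₀ (Fin (max N₀ 3)) Finset.univ (by simp) H.part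
    (fun _ _ _ a b c => {a, b, c} ∈ H.edges) (fun i _ j _ => hne i j) (by
      intro i _ j _ k _ hij hjk
      have p₁ : (0 : ℝ) < (H.part i j).card := by exact_mod_cast (hne i j hij).card_pos
      have p₂ : (0 : ℝ) < (H.part j k).card := by exact_mod_cast (hne j k hjk).card_pos
      have p₃ : (0 : ℝ) < (H.part i k).card := by
        exact_mod_cast (hne i k (hij.trans hjk)).card_pos
      have h := hH i j k hij hjk
      rw [PartitionedHypergraph.triadDensity, le_div_iff₀ (by positivity)] at h
      refine le_trans (le_of_eq (by ring)) (h.trans ?_)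
      exact_mod_cast H.card_triad_le i j k)
  have hι : ∀ i, T.orderEmbOfFin hT i ∈ T := T.orderEmbOfFin_mem hT
  have hcol : (H.restrict (T.orderEmbOfFin hT)).IsPaletteColouring P
      fun i j => φ (T.orderEmbOfFin hT i) (T.orderEmbOfFin hT j) := by
    have hmem : ∀ i j : Fin (4 * n), i < j → ∀ c,
        φ (T.orderEmbOfFin hT i) (T.orderEmbOfFin hT j) c ∈
          H.part (T.orderEmbOfFin hT i) (T.orderEmbOfFin hT j) :=
      fun i j hij => hφ _ (hι i) _ (hι j) ((T.orderEmbOfFin hT).strictMono hij)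
    refine ⟨fun c i j hij => hmem i j hij c, fun i j k hij hjk a b c h => ?_⟩
    exact H.mem_triad_restrict _ hij hjk (hmem i j hij a) (hmem j k hjk b)
      (hmem i k (hij.trans hjk) c) ((hP _ (hι i) _ (hι j) _ (hι k)
        ((T.orderEmbOfFin hT).strictMono hij) ((T.orderEmbOfFin hT).strictMono hjk) a b c).1 h)
  refine ⟨T.orderEmbOfFin hT, H.restrict _, H.restrict_isSubhypergraph _, ?_⟩
  by_contra hcases
  push Not at hcases
  obtain ⟨n₁, n₂, n₃, n₄⟩ := hcases
  have h := palette_card_le P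
    (fun _ _ _ _ _ _ h₁ h₂ h₃ => n₁ (hcol.firstCase h₁ h₂ h₃))
    (fun _ _ _ _ _ _ h₁ h₂ h₃ => n₂ (hcol.secondCase h₁ h₂ h₃))
    (fun _ _ _ _ _ _ h₁ h₂ h₃ => n₃ (hcol.thirdCase h₁ h₂ h₃))
    (fun _ _ _ _ _ _ _ _ _ _ h₁ h₂ h₃ h₄ h₅ => n₄ (hcol.swappedFourthCase hn h₁ h₂ h₃ h₄ h₅))
  rw [Nat.card_eq_fintype_card (α := Fin M), Fintype.card_fin] at h
  have hM' : (0 : ℝ) < (M : ℝ) ^ 3 := by positivity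
  nlinarith [hcard.trans h]
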